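/- **Setting.** A *bidding game* consists of a finite MDP $M$ (each vertex is either a control vertex $v$ with a nonempty set $\mathrm{succ}(v)$ of successors, or a random vertex $v$ with a rational probability distribution $\delta(v)$ on the vertices, whose support is $\mathrm{succ}(v)$), a set $T$ of target vertices, all of them sinks ($\mathrm{succ}(v)=\{v\}$), and an initial vertex. Its safety values are the sets $\text{s-val}^i_v\subseteq[0,1]^2$ of pairs (budget, probability) given by $\text{s-val}^0_v=[0,1]\times\{1\}\cup\{0\}\times[0,1]$ if $v\in T$, $\text{s-val}^0_v=[0,1]^2$ otherwise, and, for $i>0$, with $S_w=\text{s-val}^{i-1}_w$, $$\text{s-val}^i_v=\Big\{\big(B,\textstyle\sum_{w\in\mathrm{succ}(v)}\delta(v)(w)\,p_w\big)\;:\;B\in[0,1],\ (B,p_w)\in S_w\ \text{for all } w\in\mathrm{succ}(v)\Big\}$$ if $v$ is random, and $$\text{s-val}^i_v=\Big\{\big(\tfrac{B_++B_-}{2},p\big)\;:\;p\in[0,1],\ (B_-,p)\in S_w\text{ for some }w\in\mathrm{succ}(v),\ (B_+,p)\in S_w\text{ for all }w\in\mathrm{succ}(v)\Big\}$$ if $v$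 is a control vertex. Put $\text{s-val}^*_v=\bigcap_{i}\text{s-val}^i_v$. A *simple stochastic game* (SSG) $G$ has finitely many vertices, partitioned into those of Player 0, those of Player 1 and random ones; each player vertex has a nonempty set of successors, all random; each random vertex has a rational probability distribution on player vertices. It has a target set $T_G$ and an initial vertex, which belongs to Player 1, and along every infinite path from the initial vertex the vertices are, periodically, of Player 1, random, of Player 0, random. A policy of a player maps each of his vertices to one of its successors. The value of a vertex is the largest $p$ for which Player 0 has a policy such that $T_G$ is reached from that vertex with probability at least $p$ against every policy of Player 1. Games are encoded as strings over a finite alphabet (vertex names in unary, numerators and denominators of rationals in binary), and the size of a game is the length of its encoding. **Theorem.** There are a map $G\mapsto G_B$ from SSGs to bidding games and a polynomial $P$ such that for every SSG $G$ with initial vertex $v$, writing $v_B$ for the initial vertex of $G_B$: 1. the size of $G_B$ is at most $P$ of the size of $G$; 2. the value of $v$ in $G$ exists (the maximum is attained), the minimum of $\{p : (\tfrac13,p)\in\text{s-val}^*_{v_B}\}$ in $G_B$ exists, and the two are equal. Moreover, the map $(G,p)\mapsto(G_B,\tfrac13,p)$, for rational $p\in[0,1]$, is computable in polynomial time by a Turing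 machine, and the value of $v$ in $G$ is at most $p$ if and only if $(\tfrac13,p)\in\text{s-val}^*_{v_B}$ in $G_B$. Hence deciding whether $(B,p)\in\text{s-val}^*_{v}$ for a given bidding game with initial vertex $v$ and given rational $B,p\in[0,1]$ is at least as hard, under polynomial-time many-one reductions, as deciding whether the value of an SSG is at most a given rational. -/

import Mathlib

open scoped NNReal ENNReal NNRat

namespace BiddingGames

/-! ### Bidding games on Markov decision processes -/

/-- The moves available at a vertex of an MDP on the vertex set `Fin n`: at a control vertex the set
of successors among which the winner of the bidding chooses, at a random vertex the probability
distribution of the next vertex. Probabilities are rational, so that a game has a size. -/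
inductive Node (n : ℕ) where
  | control (S : Finset (Fin n))
  | random (δ : Fin n → ℚ≥0)

/-- The set of successors of a vertex. -/
def Node.succ {n : ℕ} : Node n → Finset (Fin n)
  | .control S => S
  | .random δ => Finset.univ.filter fun w => 0 < δ w

/-- A bidding game: a finite MDP (control vertices with a nonempty set of successors, random
vertices with a probability distribution) with a set of target vertices, all of which are sinks,
and an initial vertex. -/
structure BiddingGame where
  n : ℕ
  node : Fin n → Node n
  target : Finset (Fin n)
  init : Fin n
  control_nonempty : ∀ v S, node v = .control S → S.Nonempty
  random_sum : ∀ v δ, node v = .random δ → ∑ w, δ w = 1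
  target_sink : ∀ v ∈ target, (node v).succ = {v}

namespace BiddingGame

variable (M : BiddingGame)

/-- The value iteration operator `𝒯_v`, applied to sets `val w` of pairs (budget, probability). -/
def bellman (val : Fin M.n → Set (ℝ × ℝ)) (v : Fin M.n) : Set (ℝ × ℝ) :=
  match M.node v with
  | .random δ =>
      {x | ∃ B ∈ Set.Icc (0 : ℝ) 1, ∃ p : Fin M.n → ℝ,
        (∀ w ∈ (M.node v).succ, (B, p w) ∈ val w) ∧
          x = (B, ∑ w ∈ (M.node v).succ, (δ w : ℝ) * p w)}
  | .control S =>
      {x | ∃ p ∈ Set.Icc (0 : ℝ) 1, ∃ Bminus Bplus : ℝ,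
        (∃ w ∈ S, (Bminus, p) ∈ val w) ∧ (∀ w ∈ S, (Bplus, p) ∈ val w) ∧
          x = ((Bplus + Bminus) / 2, p)}

/-- The safety values `s-val^i_v`. -/
def sval : ℕ → Fin M.n → Set (ℝ × ℝ)
  | 0, v =>
      if v ∈ M.target then
        Set.Icc (0 : ℝ) 1 ×ˢ {(1 : ℝ)} ∪ {(0 : ℝ)} ×ˢ Set.Icc (0 : ℝ) 1
      else Set.Icc (0 : ℝ) 1 ×ˢ Set.Icc (0 : ℝ) 1
  | i + 1, v => M.bellman (sval i) v

/-- The limit safety value `s-val^*_v`. -/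
def svalStar (v : Fin M.n) : Set (ℝ × ℝ) := ⋂ i, M.sval i v

end BiddingGame

/-! ### Simple stochastic games -/

/-- The moves available at a vertex of a simple stochastic game: a vertex of Player 0 or of
Player 1 with its set of successors, or a random vertex with its distribution. -/
inductive SSGNode (n : ℕ) where
  | player0 (S : Finset (Fin n))
  | player1 (S : Finset (Fin n))
  | random (δ : Fin n → ℚ≥0)

namespace SSGNode

variable {n : ℕ}

/-- The vertex belongs to Player 0. -/
def IsPlayer0 (x : SSGNode n) : Prop := ∃ S, x = .player0 S

/-- The vertex belongs to Player 1. -/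
def IsPlayer1 (x : SSGNode n) : Prop := ∃ S, x = .player1 S

/-- The vertex is random. -/
def IsRandom (x : SSGNode n) : Prop := ∃ δ, x = .random δ

/-- The set of successors of a vertex. -/
def succ : SSGNode n → Finset (Fin n)
  | .player0 S => S
  | .player1 S => S
  | .random δ => Finset.univ.filter fun w => 0 < δ w

end SSGNode

/-- A simple stochastic game with a target set for Player 0 and an initial vertex. Successors of
player vertices are random, successors of random vertices are player vertices, the initial vertex
belongs to Player 1, and every infinite path from it lies in `(V₁ V_r V₀ V_r)^ω`. -/
structure SSG where
  n : ℕ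
  node : Fin n → SSGNode n
  target : Finset (Fin n)
  init : Fin n
  player_nonempty : ∀ v, (node v).IsPlayer0 ∨ (node v).IsPlayer1 → (node v).succ.Nonempty
  random_sum : ∀ v δ, node v = .random δ → ∑ w, δ w = 1
  player_succ : ∀ v, (node v).IsPlayer0 ∨ (node v).IsPlayer1 →
    ∀ w ∈ (node v).succ, (node w).IsRandom
  random_succ : ∀ v, (node v).IsRandom →
    ∀ w ∈ (node v).succ, (node w).IsPlayer0 ∨ (node w).IsPlayer1
  init_player1 : (node init).IsPlayer1
  alternating : ∀ path : ℕ → Fin n, path 0 = init →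
    (∀ i, path (i + 1) ∈ (node (path i)).succ) →
      ∀ k, (node (path (4 * k))).IsPlayer1 ∧ (node (path (4 * k + 1))).IsRandom ∧
        (node (path (4 * k + 2))).IsPlayer0 ∧ (node (path (4 * k + 3))).IsRandom

namespace SSG

variable (G : SSG)

/-- Policies of Player 0: a successor is chosen at each vertex of Player 0 (the values at other
vertices are never used). -/
def Policy0 : Type :=
  {π : Fin G.n → Fin G.n // ∀ v, (G.node v).IsPlayer0 → π v ∈ (G.node v).succ}

/-- Policies of Player 1. -/
def Policy1 : Type :=
  {π : Fin G.n → Fin G.n // ∀ v, (G.node v).IsPlayer1 → π v ∈ (G.node v).succ}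

variable {G}

/-- The probability of moving from `v` to `w` when the players use `π₀` and `π₁`. -/
noncomputable def weight (π₀ : G.Policy0) (π₁ : G.Policy1) (v w : Fin G.n) : ℝ≥0∞ :=
  match G.node v with
  | .player0 _ => if w = π₀.1 v then 1 else 0
  | .player1 _ => if w = π₁.1 v then 1 else 0
  | .random δ => ((δ w : ℝ≥0) : ℝ≥0∞)

theorem sum_weight (π₀ : G.Policy0) (π₁ : G.Policy1) (v : Fin G.n) :
    ∑ w, weight π₀ π₁ v w = 1 := by
  unfold weight
  split
  · simp
  · simp
  · rename_i δ h
    have h1 := G.random_sum v δ h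
    rw [← ENNReal.ofNNReal_finsetSum]
    have h2 : ∑ w, ((δ w : ℚ≥0) : ℝ≥0) = 1 := by exact_mod_cast congrArg (fun q : ℚ≥0 => (q : ℝ≥0)) h1
    rw [h2]
    simp

/-- The distribution of the vertex after `v`. -/
noncomputable def step (π₀ : G.Policy0) (π₁ : G.Policy1) (v : Fin G.n) : PMF (Fin G.n) :=
  PMF.ofFintype (weight π₀ π₁ v) (sum_weight π₀ π₁ v)

/-- The transition kernel of the Markov chain induced by two policies. -/
noncomputable def stepKernel (π₀ : G.Policy0) (π₁ : G.Policy1) :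
    ProbabilityTheory.Kernel (Fin G.n) (Fin G.n) :=
  ProbabilityTheory.Kernel.ofFunOfCountable fun v => (step π₀ π₁ v).toMeasure

instance (π₀ : G.Policy0) (π₁ : G.Policy1) :
    ProbabilityTheory.IsMarkovKernel (stepKernel π₀ π₁) :=
  ⟨fun v => inferInstanceAs (MeasureTheory.IsProbabilityMeasure (step π₀ π₁ v).toMeasure)⟩

/-- The same kernel, as the conditional law of the vertex at time `k + 1` given the history up to
time `k`. -/
noncomputable def historyKernel (π₀ : G.Policy0) (π₁ : G.Policy1) (k : ℕ) :
    ProbabilityTheory.Kernel (Finset.Iic k → Fin G.n) (Fin G.n) :=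
  (stepKernel π₀ π₁).comap (fun h => h ⟨k, Finset.mem_Iic.2 le_rfl⟩) (measurable_pi_apply _)

instance (π₀ : G.Policy0) (π₁ : G.Policy1) (k : ℕ) :
    ProbabilityTheory.IsMarkovKernel (historyKernel π₀ π₁ k) := by
  unfold historyKernel; infer_instance

/-- The probability measure on infinite paths from `v` induced by two policies. -/
noncomputable def pathMeasure (π₀ : G.Policy0) (π₁ : G.Policy1) (v : Fin G.n) :
    MeasureTheory.Measure (ℕ → Fin G.n) :=
  ProbabilityTheory.Kernel.traj (X := fun _ => Fin G.n) (historyKernel π₀ π₁) 0 (fun _ => v)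

/-- The probability that the target is reached from `v`. -/
noncomputable def reachProb (π₀ : G.Policy0) (π₁ : G.Policy1) (v : Fin G.n) : ℝ :=
  (pathMeasure π₀ π₁ v).real {path | ∃ i, path i ∈ G.target}

variable (G)

/-- The probabilities that Player 0 can guarantee for reaching the target from `v`. -/
def guaranteed (v : Fin G.n) : Set ℝ :=
  {p | ∃ π₀ : G.Policy0, ∀ π₁ : G.Policy1, p ≤ reachProb π₀ π₁ v}

/-- The value of a vertex: the largest probability that Player 0 can guarantee. -/
noncomputable def value (v : Fin G.n) : ℝ := sSup (G.guaranteed v)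

end SSG

/-! ### Encodings as strings over a finite alphabet, and sizes -/

/-- The alphabet. -/
inductive Symbol where
  | bit (b : Bool)
  | tick
  | over
  | comma
  | vertex
  | target
  | player0
  | player1
  | control
  | random
  | edge
  deriving DecidableEq, Fintype

/-- Nonnegative rationals are given by numerator and denominator in binary. -/
def encodeRat (q : ℚ≥0) : List Symbol :=
  (Computability.encodeNat q.num).map .bit ++
    Symbol.over :: (Computability.encodeNat q.den).map .bit

/-- Vertices are named by their number in unary. -/
def encodeVertex {n : ℕ} (v : Fin n) : List Symbol := List.replicate v.val .tick

/-- The list of the elements of a set of successors. -/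
def encodeSet {n : ℕ} (S : Finset (Fin n)) : List Symbol :=
  ((List.finRange n).filter (· ∈ S)).flatMap fun w => Symbol.edge :: encodeVertex w

/-- The list of the pairs `(w, δ w)` with `δ w ≠ 0`. -/
def encodeDist {n : ℕ} (δ : Fin n → ℚ≥0) : List Symbol :=
  ((List.finRange n).filter (δ · ≠ 0)).flatMap fun w =>
    Symbol.edge :: (encodeVertex w ++ encodeRat (δ w))

def Node.encode {n : ℕ} : Node n → List Symbol
  | .control S => .control :: encodeSet S
  | .random δ => .random :: encodeDist δ

def SSGNode.encode {n : ℕ} : SSGNode n → List Symbol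
  | .player0 S => .player0 :: encodeSet S
  | .player1 S => .player1 :: encodeSet S
  | .random δ => .random :: encodeDist δ

/-- The encoding of a graph: the initial vertex, and then the list of all vertices, each with a flag
for membership in the target set and with its outgoing transitions. -/
def encodeGraph {n : ℕ} (init : Fin n) (target : Finset (Fin n)) (node : Fin n → List Symbol) :
    List Symbol :=
  encodeVertex init ++ (List.finRange n).flatMap fun v =>
    Symbol.vertex :: ((if v ∈ target then [Symbol.target] else []) ++ node v)

def BiddingGame.encode (M : BiddingGame) : List Symbol :=
  encodeGraph M.init M.target fun v => (M.node v).encode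

def SSG.encode (G : SSG) : List Symbol :=
  encodeGraph G.init G.target fun v => (G.node v).encode

/-- The size of a bidding game is the length of its encoding. -/
def BiddingGame.size (M : BiddingGame) : ℕ := M.encode.length

/-- The size of a simple stochastic game is the length of its encoding. -/
def SSG.size (G : SSG) : ℕ := G.encode.length

/-! ### The two decision problems -/

/-- A simple stochastic game together with a rational probability `p`. -/
structure SSGInstance where
  game : SSG
  p : ℚ≥0
  p_le : p ≤ 1

/-- The question whether the value of the initial vertex is at most `p`. -/
def SSGInstance.Holds (x : SSGInstance) : Prop := x.game.value x.game.init ≤ (x.p : ℝ)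

def SSGInstance.encode (x : SSGInstance) : List Symbol :=
  encodeRat x.p ++ Symbol.comma :: x.game.encode

/-- A problem instance `⟨M, v, T, B, p⟩` with rational `B` and `p`; the initial vertex `v` and the
target `T` are part of the bidding game. -/
structure BiddingInstance where
  game : BiddingGame
  B : ℚ≥0
  B_le : B ≤ 1
  p : ℚ≥0
  p_le : p ≤ 1

/-- The question whether `(B, p)` lies in `s-val^*_v`. -/
def BiddingInstance.Holds (x : BiddingInstance) : Prop :=
  ((x.B : ℝ), (x.p : ℝ)) ∈ x.game.svalStar x.game.init

def BiddingInstance.encode (x : BiddingInstance) : List Symbol :=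
  encodeRat x.B ++ Symbol.comma :: (encodeRat x.p ++ Symbol.comma :: x.game.encode)

end BiddingGames

/-! Read the first coordinate `B` as the budget of the player who wants the target, with bids paid
to the opponent and total budget 1. The reduction keeps the graph of the game and adds a target sink
and a safe sink. A vertex of Player 1 also gets an edge to the target sink, a vertex of Player 0 one
to the safe sink, and an old target only an edge to the target sink.

The two sinks force the bids. At a vertex of Player 1 with budget 1/3 the reacher threatens to stake
everything: for `p ≠ 1` the budget `Bplus` must be safe at the target sink, so `Bplus = 0` and
`Bminus = 2/3`. The opponent has to outbid and chooses the successor, as a minimizer. At a vertex of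
Player 0 with budget 2/3 the opponent threatens to stake the remaining 1/3: since `Bminus ≤ 1`,
`Bplus ≥ 1/3`, and the safe sink allows equality. The reacher chooses, as a maximizer, and is left
with 1/3. Random vertices do not change the budget, so along the period (Player 1, random, Player 0,
random) it runs through 1/3, 2/3, 2/3, 1/3. With the budget of the phase, the `i`-th safety value at
a vertex of the game is therefore the interval from the `i`-th iterate of reachability value
iteration up to 1 (`SSG.mem_sval_shift_iff`). Intersecting over `i` leaves the interval from the
limit of value iteration to 1.

That this limit is the value, and that a policy attains it, is `SSG.isGreatest_guaranteed`. Player 1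
plays greedily for the limit. For Player 0 a greedy choice for the limit could circle for ever among
vertices of equal value, so the choice is greedy for a discounted value instead; as there are
finitely many policies, the discount can be sent to 1.

On strings the reduction is a finite-state rewriting: vertex names in unary grow by two ticks, and
fixed words are inserted or deleted. A finite-state transducer is simulated by a stack machine in
linear time, which gives both the size bound and polynomial-time computability. -/

namespace BiddingGames

/-! ### Finite-state transducers run in polynomial time -/

/-- A finite-state transducer with states `Q` on the alphabet `Γ`: it writes `header` and then, for
each symbol read, the word given by `out`. -/
structure Transducer (Γ Q : Type) where
  header : List Γ
  start : Q
  next : Q → Γ → Q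
  out : Q → Γ → List Γ

namespace Transducer

variable {Γ Q : Type} (T : Transducer Γ Q)

/-- The word written when a word is read from a given state. -/
def run (T : Transducer Γ Q) : Q → List Γ → List Γ
  | _, [] => []
  | q, a :: l => T.out q a ++ run T (T.next q a) l

/-- The state after a word is read from a given state. -/
def eval (T : Transducer Γ Q) : Q → List Γ → Q
  | q, [] => q
  | q, a :: l => eval T (T.next q a) l

theorem run_append (q : Q) (l₁ l₂ : List Γ) :
    T.run q (l₁ ++ l₂) = T.run q l₁ ++ T.run (T.eval q l₁) l₂ := by
  induction l₁ generalizing q with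
  | nil => rfl
  | cons a l ih => simp [run, eval, ih]

theorem eval_append (q : Q) (l₁ l₂ : List Γ) :
    T.eval q (l₁ ++ l₂) = T.eval (T.eval q l₁) l₂ := by
  induction l₁ generalizing q with
  | nil => rfl
  | cons a l ih => simp [eval, ih]

theorem run_of_copy {q : Q} {l : List Γ} (h : ∀ a ∈ l, T.out q a = [a] ∧ T.next q a = q) :
    T.run q l = l := by
  induction l with
  | nil => rfl
  | cons a l ih =>
    obtain ⟨h1, h2⟩ := h a (by simp)
    rw [run, h1, h2, ih fun b hb => h b (by simp [hb])]
    rfl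

theorem eval_of_loop {q : Q} {l : List Γ} (h : ∀ a ∈ l, T.next q a = q) : T.eval q l = q := by
  induction l with
  | nil => rfl
  | cons a l ih => rw [eval, h a (by simp), ih fun b hb => h b (by simp [hb])]

/-- A bound for the lengths of the words written in one step. -/
def maxOut [Fintype Γ] [Fintype Q] : ℕ :=
  Finset.univ.sup fun x : Q × Γ => (T.out x.1 x.2).length

theorem length_run_le [Fintype Γ] [Fintype Q] (q : Q) (l : List Γ) :
    (T.run q l).length ≤ T.maxOut * l.length := by
  induction l generalizing q with
  | nil => simp [run]
  | cons a l ih =>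
    have h : (T.out q a).length ≤ T.maxOut :=
      Finset.le_sup (f := fun x : Q × Γ => (T.out x.1 x.2).length) (Finset.mem_univ (q, a))
    have h' := ih (T.next q a)
    rw [run, List.length_append, List.length_cons, mul_add, mul_one]
    omega

/-- The contents of the machine simulating a transducer. -/
inductive Tape where
  | input
  | work
  | output
  deriving DecidableEq

instance : Fintype Tape := ⟨{.input, .work, .output}, fun k => by cases k <;> simp⟩

/-- The labels of the machine simulating a transducer: write the header, read a symbol in a given
state, write the word due after that symbol was read, and reverse the word written so far. -/
inductive Label (Γ Q : Type) where
  | header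
  | scan (q : Q)
  | emit (q : Q) (a : Γ)
  | reverse
  deriving Fintype

open Turing TM2.Stmt

/-- Push a fixed word on a stack. -/
def pushAll {Λ σ : Type} (k : Tape) :
    List Γ → TM2.Stmt (fun _ : Tape => Γ) Λ σ → TM2.Stmt (fun _ : Tape => Γ) Λ σ
  | [], s => s
  | a :: l, s => push k (fun _ => a) (pushAll k l s)

/-- The program of the machine simulating a transducer. The internal state is the symbol read last. -/
def program [Inhabited Γ] : Label Γ Q → TM2.Stmt (fun _ : Tape => Γ) (Label Γ Q) (Option Γ)
  | .header => pushAll .work T.header (goto fun _ => .scan T.start)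
  | .scan q => pop .input (fun _ a => a) (goto fun a => a.elim .reverse (.emit q))
  | .emit q a => pushAll .work (T.out q a) (goto fun _ => .scan (T.next q a))
  | .reverse => pop .work (fun _ a => a)
      (branch Option.isNone halt
        (push .output (fun a => a.getD default) (goto fun _ => .reverse)))

/-- The machine simulating a transducer. -/
def machine [Inhabited Γ] [Fintype Γ] [Fintype Q] : FinTM2 where
  K := Tape
  k₀ := .input
  k₁ := .output
  Γ _ := Γ
  Λ := Label Γ Q
  main := .header
  σ := Option Γ
  initialState := none
  Γk₀Fin := inferInstanceAs (Fintype Γ)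
  m := T.program

/-- Stack contents. -/
def contents (i w o : List Γ) : Tape → List Γ
  | .input => i
  | .work => w
  | .output => o

theorem update_input (i w o x : List Γ) :
    Function.update (contents i w o) .input x = contents x w o := by
  funext k; cases k <;> simp [contents]

theorem update_work (i w o x : List Γ) :
    Function.update (contents i w o) .work x = contents i x o := by
  funext k; cases k <;> simp [contents]

theorem update_output (i w o x : List Γ) :
    Function.update (contents i w o) .output x = contents i w x := by
  funext k; cases k <;> simp [contents]

/-- A word pushed on a stack ends up reversed. Hence the output is collected on the work stack and
turned around once at the end. -/
theorem stepAux_pushAll {Λ σ : Type} (l : List Γ) (s : TM2.Stmt (fun _ : Tape => Γ) Λ σ) (v : σ)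
    (i w o : List Γ) :
    TM2.stepAux (pushAll .work l s) v (contents i w o) =
      TM2.stepAux s v (contents i (l.reverse ++ w) o) := by
  induction l generalizing w with
  | nil => rfl
  | cons a l ih =>
    rw [pushAll, TM2.stepAux, update_work, ih]
    simp [contents]

/-! ### Runs of the machine simulating a transducer -/

section Correctness

variable [Inhabited Γ]

theorem step_header (v : Option Γ) (i w o : List Γ) :
    TM2.step T.program ⟨some .header, v, contents i w o⟩ =
      some ⟨some (.scan T.start), v, contents i (T.header.reverse ++ w) o⟩ := by
  rw [TM2.step, program, stepAux_pushAll, TM2.stepAux]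

theorem step_scan_nil (q : Q) (v : Option Γ) (w o : List Γ) :
    TM2.step T.program ⟨some (.scan q), v, contents [] w o⟩ =
      some ⟨some .reverse, none, contents [] w o⟩ := by
  rw [TM2.step, program, TM2.stepAux, TM2.stepAux, update_input]
  rfl

theorem step_scan_cons (q : Q) (v : Option Γ) (a : Γ) (i w o : List Γ) :
    TM2.step T.program ⟨some (.scan q), v, contents (a :: i) w o⟩ =
      some ⟨some (.emit q a), some a, contents i w o⟩ := by
  rw [TM2.step, program, TM2.stepAux, TM2.stepAux, update_input]
  rfl

theorem step_emit (q : Q) (a : Γ) (v : Option Γ) (i w o : List Γ) :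
    TM2.step T.program ⟨some (.emit q a), v, contents i w o⟩ =
      some ⟨some (.scan (T.next q a)), v, contents i ((T.out q a).reverse ++ w) o⟩ := by
  rw [TM2.step, program, stepAux_pushAll, TM2.stepAux]

theorem step_reverse_nil (v : Option Γ) (i o : List Γ) :
    TM2.step T.program ⟨some .reverse, v, contents i [] o⟩ = some ⟨none, none, contents i [] o⟩ := by
  rw [TM2.step, program, TM2.stepAux, TM2.stepAux, update_work]
  rfl

theorem step_reverse_cons (v : Option Γ) (a : Γ) (i w o : List Γ) :
    TM2.step T.program ⟨some .reverse, v, contents i (a :: w) o⟩ =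
      some ⟨some .reverse, some a, contents i w (a :: o)⟩ := by
  rw [TM2.step, program, TM2.stepAux, TM2.stepAux]
  simp only [contents, List.head?_cons, Option.isNone_some, cond_false, TM2.stepAux]
  change some (⟨some Label.reverse, some a, Function.update (Function.update (contents i (a :: w) o)
    .work w) .output (a :: o)⟩ : TM2.Cfg _ _ _) = _
  rw [update_work]
  exact congrArg (fun S => some (⟨some Label.reverse, some a, S⟩ : TM2.Cfg _ _ _))
    (update_output i w o (a :: o))

theorem evals_reverse (v : Option Γ) (i w o : List Γ) :
    (flip bind (TM2.step T.program))^[w.length + 1] (some ⟨some .reverse, v, contents i w o⟩) =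
      some ⟨none, none, contents i [] (w.reverse ++ o)⟩ := by
  induction w generalizing v o with
  | nil => exact T.step_reverse_nil v i o
  | cons a w ih =>
    rw [List.length_cons, Function.iterate_succ_apply]
    change (flip bind (TM2.step T.program))^[w.length + 1]
      (TM2.step T.program ⟨some .reverse, v, contents i (a :: w) o⟩) = _
    rw [step_reverse_cons, ih]
    simp

/-- Each input symbol costs two machine steps, one to pop it and one to write its word; the last
step notices the empty stack. -/
theorem evals_scan (q : Q) (v : Option Γ) (i w o : List Γ) :
    (flip bind (TM2.step T.program))^[2 * i.length + 1] (some ⟨some (.scan q), v, contents i w o⟩) =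
      some ⟨some .reverse, none, contents [] ((T.run q i).reverse ++ w) o⟩ := by
  induction i generalizing q v w with
  | nil => exact T.step_scan_nil q v w o
  | cons a i ih =>
    rw [List.length_cons, mul_add, mul_one, add_right_comm, Function.iterate_succ_apply,
      Function.iterate_succ_apply]
    change (flip bind (TM2.step T.program))^[2 * i.length + 1]
      ((TM2.step T.program ⟨some (.scan q), v, contents (a :: i) w o⟩).bind
        (TM2.step T.program)) = _
    rw [step_scan_cons, Option.bind_some, step_emit, ih, run]
    simp

theorem evals_header (i : List Γ) :
    (flip bind (TM2.step T.program))^[((T.header ++ T.run T.start i).length + 1) +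
        (2 * i.length + 1) + 1] (some ⟨some .header, none, contents i [] []⟩) =
      some ⟨none, none, contents [] [] (T.header ++ T.run T.start i)⟩ := by
  rw [Function.iterate_succ_apply, Function.iterate_add_apply]
  change (flip bind (TM2.step T.program))^[_] ((flip bind (TM2.step T.program))^[_]
      (TM2.step T.program ⟨some .header, none, contents i [] []⟩)) = _
  rw [step_header, evals_scan]
  have h := T.evals_reverse none []
    ((T.run T.start i).reverse ++ (T.header.reverse ++ [])) []
  simpa [add_comm] using h

end Correctness

theorem initList_machine [Inhabited Γ] [Fintype Γ] [Fintype Q] (l : List Γ) :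
    initList T.machine l = ⟨some .header, none, contents l [] []⟩ := by
  unfold initList
  congr 1
  funext k
  cases k <;> rfl

theorem haltList_machine [Inhabited Γ] [Fintype Γ] [Fintype Q] (l : List Γ) :
    haltList T.machine l = ⟨none, none, contents [] [] l⟩ := by
  unfold haltList
  congr 1
  funext k
  cases k <;> rfl

/-- A function that is given on encodings by a finite-state transducer is computable in polynomial
time. -/
theorem nonempty_computableInPolyTime [Inhabited Γ] [Fintype Γ] [Fintype Q] {α β : Type}
    (ea : α → List Γ) (eb : β → List Γ) (f : α → β)
    (h : ∀ a, eb (f a) = T.header ++ T.run T.start (ea a)) :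
    Nonempty (TM2ComputableInPolyTime ea eb f) :=
  ⟨{ tm := T.machine
     inputAlphabet := Equiv.refl Γ
     outputAlphabet := Equiv.refl Γ
     -- Two steps per input symbol, one per output symbol in the reversal, and three for the header
     -- and the ends of the two loops. The output has at most `T.header.length` plus `T.maxOut`
     -- times the input length symbols.
     time := Polynomial.C (T.maxOut + 2) * Polynomial.X + Polynomial.C (T.header.length + 3)
     outputsFun := fun a =>
      { steps := ((T.header ++ T.run T.start (ea a)).length + 1) + (2 * (ea a).length + 1) + 1
        evals_in_steps := by
          have e1 := (congrArg (initList T.machine) (List.map_id (ea a))).trans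
            (T.initList_machine (ea a))
          have e2 := (congrArg (haltList T.machine) (List.map_id (eb (f a)))).trans
            ((T.haltList_machine (eb (f a))).trans (congrArg
              (fun l => (⟨none, none, contents [] [] l⟩ : T.machine.Cfg)) (h a)))
          exact (congrArg _ (congrArg some e1)).trans
            ((T.evals_header (ea a)).trans (congrArg some e2.symm))
        steps_le_m := by
          have := T.length_run_le T.start (ea a)
          simp only [Polynomial.eval_add, Polynomial.eval_mul, Polynomial.eval_C,
            Polynomial.eval_X, List.length_append]
          linarith } }⟩

end Transducer

/-! ### The reduction -/

/-- The embedding of the vertices of a game into those of its reduction, where `0` and `1` are the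
target sink and the safe sink. -/
def shift {n : ℕ} : Fin n ↪ Fin (n + 2) := (Fin.succEmb n).trans (Fin.succEmb (n + 1))

theorem shift_apply {n : ℕ} (v : Fin n) : shift v = v.succ.succ := rfl

theorem zero_notMem_map_shift {n : ℕ} (S : Finset (Fin n)) : (0 : Fin (n + 2)) ∉ S.map shift := by
  simp [shift_apply, Fin.succ_ne_zero]

theorem one_notMem_map_shift {n : ℕ} (S : Finset (Fin n)) : (1 : Fin (n + 2)) ∉ S.map shift := by
  simp only [Finset.mem_map, shift_apply, not_exists, not_and]
  intro x _ h
  have := congrArg Fin.val h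
  simp at this

/-- The distribution of a random vertex, on the vertices of the reduction. -/
def shiftDist {n : ℕ} (δ : Fin n → ℚ≥0) : Fin (n + 2) → ℚ≥0 := Fin.cons 0 (Fin.cons 0 δ)

@[simp] theorem shiftDist_zero {n : ℕ} (δ : Fin n → ℚ≥0) : shiftDist δ 0 = 0 := rfl

@[simp] theorem shiftDist_one {n : ℕ} (δ : Fin n → ℚ≥0) : shiftDist δ 1 = 0 := rfl

/-- The moves at a vertex that is not a target: a vertex of Player 1 gets the target sink and a
vertex of Player 0 the safe sink as an additional successor. -/
def SSGNode.toNode {n : ℕ} : SSGNode n → Node (n + 2)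
  | .player0 S => .control (insert 1 (S.map shift))
  | .player1 S => .control (insert 0 (S.map shift))
  | .random δ => .random (shiftDist δ)

namespace SSG

variable (G : SSG)

/-- The moves in the reduction at a vertex of the game. -/
def shiftedNode (v : Fin G.n) : Node (G.n + 2) :=
  if v ∈ G.target then .control {0} else (G.node v).toNode

/-- The moves in the reduction. -/
def toNode : Fin (G.n + 2) → Node (G.n + 2) :=
  Fin.cons (.control {0}) (Fin.cons (.control {1}) G.shiftedNode)

/-- The bidding game of a simple stochastic game. -/
def toBiddingGame : BiddingGame where
  n := G.n + 2
  node := G.toNode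
  target := {0}
  init := shift G.init
  control_nonempty := by
    intro v S h
    induction v using Fin.cases with
    | zero => cases h; simp
    | succ v =>
      induction v using Fin.cases with
      | zero => cases h; simp
      | succ v =>
        change G.shiftedNode v = _ at h
        unfold shiftedNode at h
        split_ifs at h
        · cases h; simp
        · cases hv : G.node v <;> rw [hv] at h <;> cases h <;> simp
  random_sum := by
    intro v δ h
    induction v using Fin.cases with
    | zero => cases h
    | succ v =>
      induction v using Fin.cases with
      | zero => cases h
      | succ v =>
        change G.shiftedNode v = _ at h
        unfold shiftedNode at h
        split_ifs at h
        cases hv : G.node v <;> rw [hv] at h <;> cases h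
        rw [Fin.sum_univ_succ, Fin.sum_univ_succ, ← G.random_sum v _ hv]
        exact (zero_add _).trans (zero_add _)
  target_sink := by
    intro v hv
    rw [Finset.mem_singleton] at hv
    subst hv
    rfl

end SSG

/-- The reduction on problem instances, with budget `1 / 3`. -/
def SSGInstance.toBiddingInstance (x : SSGInstance) : BiddingInstance where
  game := x.game.toBiddingGame
  B := 1 / 3
  B_le := by rw [div_le_one] <;> norm_num
  p := x.p
  p_le := x.p_le

/-! ### The reduction as a transducer -/

instance : Inhabited Symbol := ⟨.tick⟩

/-- The states of the transducer: before the initial vertex, in its name, at the beginning of the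
description of a vertex, in the description of a vertex, and in one that is to be ignored. -/
inductive Mode where
  | value
  | initial
  | node
  | body
  | skip
  deriving DecidableEq

instance : Fintype Mode :=
  ⟨{.value, .initial, .node, .body, .skip}, fun q => by cases q <;> simp⟩

/-- The next state of the transducer. -/
def reductionNext : Mode → Symbol → Mode
  | .value, .comma => .initial
  | .value, _ => .value
  | .initial, .vertex => .node
  | .initial, _ => .initial
  | .node, .target => .skip
  | .node, _ => .body
  | .body, .vertex => .node
  | .body, _ => .body
  | .skip, .vertex => .node
  | .skip, _ => .skip

/-- The output of the transducer. -/
def reductionOut : Mode → Symbol → List Symbol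
  | .value, .comma => [.comma, .tick, .tick]
  | .value, a => [a]
  | .initial, .vertex => [.vertex, .target, .control, .edge, .vertex, .control, .edge, .tick]
  | .initial, a => [a]
  | .node, .target => [.vertex, .control, .edge]
  | .node, .player0 => [.vertex, .control, .edge, .tick]
  | .node, .player1 => [.vertex, .control, .edge]
  | .node, .random => [.vertex, .random]
  | .node, _ => []
  | .body, .vertex => []
  | .body, .edge => [.edge, .tick, .tick]
  | .body, a => [a]
  | .skip, _ => []

/-- The transducer that computes the reduction. -/
def reduction : Transducer Symbol Mode where
  header := encodeRat (1 / 3) ++ [.comma]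
  start := .value
  next := reductionNext
  out := reductionOut

theorem Transducer.run_eval_flatMap {Γ Q α : Type} (T : Transducer Γ Q) {q : Q} {L : List α}
    {f g : α → List Γ} (h : ∀ x ∈ L, T.run q (f x) = g x ∧ T.eval q (f x) = q) :
    T.run q (L.flatMap f) = L.flatMap g ∧ T.eval q (L.flatMap f) = q := by
  induction L with
  | nil => exact ⟨rfl, rfl⟩
  | cons x L ih =>
    obtain ⟨h1, h2⟩ := h x (by simp)
    obtain ⟨h3, h4⟩ := ih fun y hy => h y (by simp [hy])
    rw [List.flatMap_cons, List.flatMap_cons, run_append, eval_append, h1, h2, h3, h4]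
    exact ⟨rfl, rfl⟩

/-! ### Symbols that occur in encodings -/

theorem mem_encodeRat {q : ℚ≥0} {a : Symbol} (h : a ∈ encodeRat q) :
    a = .over ∨ ∃ b, a = .bit b := by
  simp only [encodeRat, List.mem_append, List.mem_map, List.mem_cons] at h
  rcases h with ⟨b, -, rfl⟩ | rfl | ⟨b, -, rfl⟩ <;> simp

theorem mem_encodeVertex {n : ℕ} {v : Fin n} {a : Symbol} (h : a ∈ encodeVertex v) : a = .tick :=
  List.eq_of_mem_replicate h

theorem mem_encodeSet {n : ℕ} {S : Finset (Fin n)} {a : Symbol} (h : a ∈ encodeSet S) :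
    a = .edge ∨ a = .tick := by
  simp only [encodeSet, List.mem_flatMap, List.mem_cons] at h
  obtain ⟨w, -, rfl | h⟩ := h
  · exact .inl rfl
  · exact .inr (mem_encodeVertex h)

theorem mem_encodeDist {n : ℕ} {δ : Fin n → ℚ≥0} {a : Symbol} (h : a ∈ encodeDist δ) :
    a = .edge ∨ a = .tick ∨ a = .over ∨ ∃ b, a = .bit b := by
  simp only [encodeDist, List.mem_flatMap, List.mem_cons, List.mem_append] at h
  obtain ⟨w, -, rfl | h | h⟩ := h
  · exact .inl rfl
  · exact .inr (.inl (mem_encodeVertex h))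
  · exact .inr (.inr (mem_encodeRat h))

/-- Makes `vertex` a reliable delimiter: a transducer that ignores the moves of a target vertex
finds the beginning of the next description. -/
theorem SSGNode.vertex_notMem_encode {n : ℕ} (x : SSGNode n) : Symbol.vertex ∉ x.encode := by
  intro h
  cases x <;> simp only [SSGNode.encode, List.mem_cons, reduceCtorEq, false_or] at h
  · simpa using mem_encodeSet h
  · simpa using mem_encodeSet h
  · simpa using mem_encodeDist h

/-! ### Encodings over the enlarged vertex set -/

theorem encodeVertex_shift {n : ℕ} (v : Fin n) :
    encodeVertex (shift v) = .tick :: .tick :: encodeVertex v := rfl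

theorem finRange_add_two (n : ℕ) :
    List.finRange (n + 2) = 0 :: 1 :: (List.finRange n).map shift := by
  rw [List.finRange_succ, List.finRange_succ]
  simp [shift_apply]

theorem filter_map_shift {n : ℕ} (p : Fin (n + 2) → Bool) :
    ((List.finRange n).map shift).filter p = ((List.finRange n).filter (p ∘ shift)).map shift :=
  List.filter_map

/-- The sinks have the smallest numbers, so the additional edge is listed first and can be written
as soon as the owner of the vertex is read. The name of `0` is the empty word. -/
theorem encodeSet_insert_zero {n : ℕ} (S : Finset (Fin n)) :
    encodeSet (insert 0 (S.map shift)) = .edge ::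
      ((List.finRange n).filter (· ∈ S)).flatMap fun w =>
        .edge :: .tick :: .tick :: encodeVertex w := by
  have h : ∀ w : Fin n, shift w ≠ 0 := fun w => Fin.succ_ne_zero _
  rw [encodeSet, finRange_add_two, List.filter_cons_of_pos (by simp),
    List.filter_cons_of_neg (by simpa using one_notMem_map_shift S), filter_map_shift,
    List.flatMap_cons, List.flatMap_map]
  simp [encodeVertex_shift, h, Function.comp_def]
  simp [encodeVertex]

theorem encodeSet_insert_one {n : ℕ} (S : Finset (Fin n)) :
    encodeSet (insert 1 (S.map shift)) = .edge :: .tick ::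
      ((List.finRange n).filter (· ∈ S)).flatMap fun w =>
        .edge :: .tick :: .tick :: encodeVertex w := by
  have h : ∀ w : Fin n, shift w ≠ 1 := fun w => by
    intro h
    exact one_notMem_map_shift {w} (by simp [h])
  rw [encodeSet, finRange_add_two,
    List.filter_cons_of_neg (by simpa using zero_notMem_map_shift S),
    List.filter_cons_of_pos (by simp), filter_map_shift, List.flatMap_cons, List.flatMap_map]
  simp [encodeVertex_shift, h, Function.comp_def]
  simp [encodeVertex]

theorem encodeSet_singleton_zero (n : ℕ) : encodeSet ({0} : Finset (Fin (n + 2))) = [.edge] := by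
  have h := encodeSet_insert_zero (∅ : Finset (Fin n))
  simpa using h

theorem encodeSet_singleton_one (n : ℕ) :
    encodeSet ({1} : Finset (Fin (n + 2))) = [.edge, .tick] := by
  have h := encodeSet_insert_one (∅ : Finset (Fin n))
  simpa using h

theorem encodeDist_shiftDist {n : ℕ} (δ : Fin n → ℚ≥0) :
    encodeDist (shiftDist δ) = ((List.finRange n).filter (δ · ≠ 0)).flatMap fun w =>
      .edge :: .tick :: .tick :: (encodeVertex w ++ encodeRat (δ w)) := by
  rw [encodeDist, finRange_add_two, List.filter_cons_of_neg (by simp),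
    List.filter_cons_of_neg (by simp), filter_map_shift, List.flatMap_map]
  rfl

/-! ### The transducer writes the encoding of the reduction -/

namespace reduction

theorem run_eval_body_encodeVertex {n : ℕ} (v : Fin n) :
    reduction.run .body (encodeVertex v) = encodeVertex v ∧
      reduction.eval .body (encodeVertex v) = .body := by
  have h : ∀ a ∈ encodeVertex v, reduction.out .body a = [a] ∧ reduction.next .body a = .body := by
    intro a ha
    rw [mem_encodeVertex ha]
    exact ⟨rfl, rfl⟩
  exact ⟨reduction.run_of_copy h, reduction.eval_of_loop fun a ha => (h a ha).2⟩

theorem run_eval_body_encodeRat (q : ℚ≥0) :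
    reduction.run .body (encodeRat q) = encodeRat q ∧
      reduction.eval .body (encodeRat q) = .body := by
  have h : ∀ a ∈ encodeRat q, reduction.out .body a = [a] ∧ reduction.next .body a = .body := by
    intro a ha
    rcases mem_encodeRat ha with rfl | ⟨b, rfl⟩ <;> exact ⟨rfl, rfl⟩
  exact ⟨reduction.run_of_copy h, reduction.eval_of_loop fun a ha => (h a ha).2⟩

theorem run_eval_body_encodeSet {n : ℕ} (S : Finset (Fin n)) :
    reduction.run .body (encodeSet S) = (((List.finRange n).filter (· ∈ S)).flatMap fun w =>
        .edge :: .tick :: .tick :: encodeVertex w) ∧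
      reduction.eval .body (encodeSet S) = .body :=
  reduction.run_eval_flatMap fun w _ =>
    ⟨congrArg ([Symbol.edge, .tick, .tick] ++ ·) (run_eval_body_encodeVertex w).1,
      (run_eval_body_encodeVertex w).2⟩

theorem run_eval_body_encodeDist {n : ℕ} (δ : Fin n → ℚ≥0) :
    reduction.run .body (encodeDist δ) = encodeDist (shiftDist δ) ∧
      reduction.eval .body (encodeDist δ) = .body := by
  rw [encodeDist_shiftDist]
  refine reduction.run_eval_flatMap fun w _ => ?_
  obtain ⟨h1, h2⟩ := run_eval_body_encodeVertex w
  obtain ⟨h3, h4⟩ := run_eval_body_encodeRat (δ w)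
  constructor
  · rw [Transducer.run]
    change [Symbol.edge, .tick, .tick] ++ reduction.run .body _ = _
    rw [Transducer.run_append, h1, h2, h3]
    rfl
  · rw [Transducer.eval]
    change reduction.eval .body _ = _
    rw [Transducer.eval_append, h2, h4]

theorem run_eval_node_encode {n : ℕ} (x : SSGNode n) :
    reduction.run .node x.encode = .vertex :: x.toNode.encode ∧
      reduction.eval .node x.encode = .body := by
  cases x with
  | player0 S =>
    obtain ⟨h1, h2⟩ := run_eval_body_encodeSet S
    refine ⟨?_, h2⟩
    rw [SSGNode.toNode, Node.encode, encodeSet_insert_one, ← h1]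
    rfl
  | player1 S =>
    obtain ⟨h1, h2⟩ := run_eval_body_encodeSet S
    refine ⟨?_, h2⟩
    rw [SSGNode.toNode, Node.encode, encodeSet_insert_zero, ← h1]
    rfl
  | random δ =>
    obtain ⟨h1, h2⟩ := run_eval_body_encodeDist δ
    refine ⟨?_, h2⟩
    rw [SSGNode.toNode, Node.encode, ← h1]
    rfl

theorem run_skip (l : List Symbol) (h : Symbol.vertex ∉ l) :
    reduction.run .skip l = [] ∧ reduction.eval .skip l = .skip := by
  induction l with
  | nil => exact ⟨rfl, rfl⟩
  | cons a l ih =>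
    rw [List.mem_cons, not_or] at h
    have h1 : reduction.next .skip a = .skip := by
      cases a <;> first | rfl | exact absurd rfl h.1
    rw [Transducer.run, Transducer.eval, h1]
    exact ih h.2

/-- The description of a vertex of a simple stochastic game. -/
def block (G : SSG) (v : Fin G.n) : List Symbol :=
  .vertex :: ((if v ∈ G.target then [.target] else []) ++ (G.node v).encode)

/-- The symbol `vertex` leads to the state `node` without output from both states; it is written
only once it is known whether a target flag follows. -/
theorem run_block (G : SSG) (v : Fin G.n) (q : Mode) (hq : q = .body ∨ q = .skip) :
    reduction.run q (block G v) = .vertex :: (G.shiftedNode v).encode ∧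
      (reduction.eval q (block G v) = .body ∨ reduction.eval q (block G v) = .skip) := by
  have h1 : reduction.run q (block G v) = reduction.run .node (block G v).tail := by
    rcases hq with rfl | rfl <;> rfl
  have h2 : reduction.eval q (block G v) = reduction.eval .node (block G v).tail := by
    rcases hq with rfl | rfl <;> rfl
  rw [h1, h2, block, List.tail_cons, SSG.shiftedNode]
  split_ifs with hv
  · obtain ⟨h3, h4⟩ := run_skip _ (G.node v).vertex_notMem_encode
    refine ⟨?_, .inr h4⟩
    rw [Node.encode, encodeSet_singleton_zero]
    exact congrArg ([Symbol.vertex, .control, .edge] ++ ·) h3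
  · obtain ⟨h3, h4⟩ := run_eval_node_encode (G.node v)
    exact ⟨h3, .inl h4⟩

theorem run_blocks (G : SSG) (L : List (Fin G.n)) (q : Mode) (hq : q = .body ∨ q = .skip) :
    reduction.run q (L.flatMap (block G)) =
      L.flatMap fun v => .vertex :: (G.shiftedNode v).encode := by
  induction L generalizing q with
  | nil => rfl
  | cons v L ih =>
    obtain ⟨h1, h2⟩ := run_block G v q hq
    rw [List.flatMap_cons, List.flatMap_cons, Transducer.run_append, h1, ih _ h2]

theorem run_initial_encodeVertex {n : ℕ} (v : Fin n) :
    reduction.run .initial (encodeVertex v) = encodeVertex v ∧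
      reduction.eval .initial (encodeVertex v) = .initial := by
  have h : ∀ a ∈ encodeVertex v,
      reduction.out .initial a = [a] ∧ reduction.next .initial a = .initial := by
    intro a ha
    rw [mem_encodeVertex ha]
    exact ⟨rfl, rfl⟩
  exact ⟨reduction.run_of_copy h, reduction.eval_of_loop fun a ha => (h a ha).2⟩

theorem encode_toBiddingGame (G : SSG) :
    G.toBiddingGame.encode = .tick :: .tick :: (encodeVertex G.init ++
      [.vertex, .target, .control, .edge, .vertex, .control, .edge, .tick] ++
        (List.finRange G.n).flatMap fun v => .vertex :: (G.shiftedNode v).encode) := by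
  have h : ∀ w : Fin G.n, shift w ≠ 0 := fun w => Fin.succ_ne_zero _
  change encodeVertex (shift G.init) ++ (List.finRange (G.n + 2)).flatMap (fun v =>
    Symbol.vertex :: ((if v ∈ ({0} : Finset (Fin (G.n + 2))) then [Symbol.target] else []) ++
      (G.toNode v).encode)) = _
  rw [finRange_add_two, List.flatMap_cons, List.flatMap_cons, List.flatMap_map]
  have e0 : (G.toNode 0).encode = [.control, .edge] :=
    congrArg (Symbol.control :: ·) (encodeSet_singleton_zero G.n)
  have e1 : (G.toNode 1).encode = [.control, .edge, .tick] :=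
    congrArg (Symbol.control :: ·) (encodeSet_singleton_one G.n)
  have e2 : ∀ v, G.toNode (shift v) = G.shiftedNode v := fun _ => rfl
  simp [e0, e1, e2, h, encodeVertex_shift]

theorem run_initial_encode (G : SSG) :
    Symbol.tick :: .tick :: reduction.run .initial G.encode = G.toBiddingGame.encode := by
  obtain ⟨h1, h2⟩ := run_initial_encodeVertex G.init
  rw [encode_toBiddingGame, ← run_blocks G _ .body (.inl rfl)]
  change _ :: _ :: reduction.run .initial
    (encodeVertex G.init ++ (List.finRange G.n).flatMap (block G)) = _
  rw [Transducer.run_append, h1, h2]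
  -- The two sinks are written when the first `vertex` is read, so there must be one: the initial
  -- vertex exists.
  have hne : List.finRange G.n ≠ [] := List.ne_nil_of_mem (List.mem_finRange G.init)
  obtain ⟨v, L, hL⟩ := List.exists_cons_of_ne_nil hne
  rw [hL, List.append_assoc]
  rfl

theorem run_start_encode (x : SSGInstance) :
    reduction.header ++ reduction.run reduction.start x.encode = x.toBiddingInstance.encode := by
  have h : ∀ a ∈ encodeRat x.p,
      reduction.out .value a = [a] ∧ reduction.next .value a = .value := by
    intro a ha
    rcases mem_encodeRat ha with rfl | ⟨b, rfl⟩ <;> exact ⟨rfl, rfl⟩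
  have h1 := reduction.run_of_copy h
  have h2 := reduction.eval_of_loop fun a ha => (h a ha).2
  change (encodeRat (1 / 3) ++ [.comma]) ++
    reduction.run .value (encodeRat x.p ++ Symbol.comma :: x.game.encode) =
    encodeRat (1 / 3) ++ Symbol.comma ::
      (encodeRat x.p ++ Symbol.comma :: x.game.toBiddingGame.encode)
  rw [Transducer.run_append, h1, h2, ← run_initial_encode]
  simp [Transducer.run]
  rfl

end reduction

theorem nonempty_computableInPolyTime_toBiddingInstance :
    Nonempty (Turing.TM2ComputableInPolyTime SSGInstance.encode BiddingInstance.encode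
      SSGInstance.toBiddingInstance) :=
  reduction.nonempty_computableInPolyTime _ _ _ fun x => (reduction.run_start_encode x).symm

theorem SSG.size_toBiddingGame_le (G : SSG) :
    G.toBiddingGame.size ≤ reduction.maxOut * G.size + 2 := by
  have h := reduction.length_run_le .initial G.encode
  rw [BiddingGame.size, ← reduction.run_initial_encode]
  exact Nat.add_le_add_right h 2


namespace SSG

variable {G : SSG}

/-! ### Reachability probabilities under fixed policies -/

open MeasureTheory ProbabilityTheory

theorem lintegral_stepKernel (π₀ : G.Policy0) (π₁ : G.Policy1) (v : Fin G.n)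
    (h : Fin G.n → ℝ≥0∞) :
    ∫⁻ w, h w ∂(stepKernel π₀ π₁ v) = ∑ w, weight π₀ π₁ v w * h w := by
  rw [lintegral_fintype]
  refine Finset.sum_congr rfl fun w _ => ?_
  change h w * (step π₀ π₁ v).toMeasure {w} = _
  rw [PMF.toMeasure_apply_singleton _ _ (measurableSet_singleton w), mul_comm]
  rfl

/-- The one-step operator of the reachability objective under fixed policies. -/
noncomputable def reachStep (π₀ : G.Policy0) (π₁ : G.Policy1) (h : Fin G.n → ℝ≥0∞) (v : Fin G.n) :
    ℝ≥0∞ :=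
  if v ∈ G.target then 1 else ∑ w, weight π₀ π₁ v w * h w

-- The Markov property at time `k`: the joint law of the history up to `k` and the next vertex is
-- the law of the history composed with the kernel, so the last vertex can be integrated out first.
-- The condition on `h` makes a hit exactly at time `k + 1` agree with both branches.
open scoped Classical in
theorem lintegral_hit_succ (π₀ : G.Policy0) (π₁ : G.Policy1) (v : Fin G.n) (k : ℕ)
    {h : Fin G.n → ℝ≥0∞} (hT : ∀ w ∈ G.target, h w = 1) :
    ∫⁻ x, (if ∃ i ≤ k + 1, x i ∈ G.target then 1 else h (x (k + 1))) ∂(pathMeasure π₀ π₁ v) =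
      ∫⁻ x, (if ∃ i ≤ k, x i ∈ G.target then 1 else reachStep π₀ π₁ h (x k))
        ∂(pathMeasure π₀ π₁ v) := by
  let F : (Finset.Iic k → Fin G.n) × Fin G.n → ℝ≥0∞ := fun y =>
    if ∃ i, y.1 i ∈ G.target then 1 else h y.2
  let F' : (Finset.Iic k → Fin G.n) → ℝ≥0∞ := fun y =>
    if ∃ i, y i ∈ G.target then 1 else
      ∑ w, weight π₀ π₁ (y ⟨k, Finset.mem_Iic.2 le_rfl⟩) w * h w
  have hmF : Measurable F := .of_discrete
  have hmF' : Measurable F' := .of_discrete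
  have hex : ∀ x : ℕ → Fin G.n, (∃ i, Preorder.frestrictLe (π := fun _ => Fin G.n) k x i ∈ G.target)
      ↔ ∃ i ≤ k, x i ∈ G.target := by
    intro x
    constructor
    · rintro ⟨i, hi⟩
      exact ⟨i.1, Finset.mem_Iic.1 i.2, hi⟩
    · rintro ⟨i, hik, hi⟩
      exact ⟨⟨i, Finset.mem_Iic.2 hik⟩, hi⟩
  have e1 : ∀ x : ℕ → Fin G.n, (if ∃ i ≤ k + 1, x i ∈ G.target then 1 else h (x (k + 1))) =
      F (Preorder.frestrictLe (π := fun _ => Fin G.n) k x, x (k + 1)) := by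
    intro x
    simp only [F, hex]
    by_cases h1 : ∃ i ≤ k, x i ∈ G.target
    · obtain ⟨i, hi, hx⟩ := h1
      rw [if_pos ⟨i, by omega, hx⟩, if_pos ⟨i, hi, hx⟩]
    · rw [if_neg h1]
      split_ifs with h2
      · obtain ⟨i, hi, hx⟩ := h2
        obtain rfl : i = k + 1 := by
          by_contra hne
          exact h1 ⟨i, by omega, hx⟩
        exact (hT _ hx).symm
      · rfl
  have e2 : ∀ x : ℕ → Fin G.n, (if ∃ i ≤ k, x i ∈ G.target then 1 else reachStep π₀ π₁ h (x k)) =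
      F' (Preorder.frestrictLe (π := fun _ => Fin G.n) k x) := by
    intro x
    simp only [F', hex]
    split_ifs with h1
    · rfl
    · rw [reachStep, if_neg fun hk => h1 ⟨k, le_rfl, hk⟩]
      rfl
  have hmap := Kernel.partialTraj_compProd_eq_map_traj (X := fun _ => Fin G.n)
    (κ := historyKernel π₀ π₁) (Nat.zero_le k) (x₀ := fun _ => v)
  have hmap' := Kernel.traj_map_frestrictLe_apply (X := fun _ => Fin G.n)
    (κ := historyKernel π₀ π₁) 0 k (fun _ => v)
  rw [lintegral_congr e1, lintegral_congr e2]
  unfold pathMeasure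
  have hm1 : Measurable fun x : ℕ → Fin G.n =>
    (Preorder.frestrictLe (π := fun _ => Fin G.n) k x, x (k + 1)) := by fun_prop
  have hm2 : Measurable (Preorder.frestrictLe (π := fun _ => Fin G.n) k) := by fun_prop
  rw [← lintegral_map hmF hm1, ← hmap, Measure.lintegral_compProd hmF, ← hmap',
    lintegral_map ?_ hm2]
  · refine lintegral_congr fun x => ?_
    change ∫⁻ w, F (Preorder.frestrictLe (π := fun _ => Fin G.n) k x, w)
      ∂(stepKernel π₀ π₁ (x k)) = _
    rw [lintegral_stepKernel]
    simp only [F, F', hex]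
    split_ifs with h1
    · simpa using sum_weight π₀ π₁ (x k)
    · rfl
  · exact .of_discrete

open scoped Classical in
theorem lintegral_hit (π₀ : G.Policy0) (π₁ : G.Policy1) (v : Fin G.n) (k : ℕ)
    {h : Fin G.n → ℝ≥0∞} (hT : ∀ w ∈ G.target, h w = 1) :
    ∫⁻ x, (if ∃ i ≤ k, x i ∈ G.target then 1 else h (x k)) ∂(pathMeasure π₀ π₁ v) =
      (reachStep π₀ π₁)^[k] h v := by
  induction k generalizing h with
  | zero =>
    trans ∫⁻ x, h (Preorder.frestrictLe (π := fun _ => Fin G.n) 0 x ⟨0, by simp⟩)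
      ∂(pathMeasure π₀ π₁ v)
    · refine lintegral_congr fun x => ?_
      split_ifs with h1
      · obtain ⟨i, hi, hx⟩ := h1
        obtain rfl : i = 0 := by omega
        exact (hT _ hx).symm
      · rfl
    have hmap' := Kernel.traj_map_frestrictLe_apply (X := fun _ => Fin G.n)
      (κ := historyKernel π₀ π₁) 0 0 (fun _ => v)
    have hm2 : Measurable (Preorder.frestrictLe (π := fun _ => Fin G.n) 0) := by fun_prop
    unfold pathMeasure
    rw [← lintegral_map (f := fun y : Finset.Iic 0 → Fin G.n => h (y ⟨0, by simp⟩))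
      .of_discrete hm2, hmap', Kernel.partialTraj_self, Kernel.id_apply, lintegral_dirac]
    rfl
  | succ k ih =>
    rw [lintegral_hit_succ _ _ _ _ hT, ih, Function.iterate_succ_apply]
    intro w hw
    rw [reachStep, if_pos hw]

theorem pathMeasure_hit_le (π₀ : G.Policy0) (π₁ : G.Policy1) (v : Fin G.n) (k : ℕ) :
    pathMeasure π₀ π₁ v {x | ∃ i ≤ k, x i ∈ G.target} = (reachStep π₀ π₁)^[k + 1] 0 v := by
  classical
  -- The terminal function `reachStep π₀ π₁ 0` is the indicator of the target, which is why `k + 1`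
  -- iterations from `0` account for the times up to `k`.
  have h := lintegral_hit π₀ π₁ v k (h := reachStep π₀ π₁ 0) fun w hw => by
    rw [reachStep, if_pos hw]
  rw [Function.iterate_succ_apply, ← h]
  have hm : MeasurableSet {x : ℕ → Fin G.n | ∃ i ≤ k, x i ∈ G.target} := by
    have : {x : ℕ → Fin G.n | ∃ i ≤ k, x i ∈ G.target} =
        ⋃ i ∈ Set.Iic k, (fun x : ℕ → Fin G.n => x i) ⁻¹' G.target := by
      ext x; simp
    rw [this]
    exact .biUnion (Set.to_countable _) fun i _ => measurable_pi_apply i .of_discrete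
  rw [← lintegral_indicator_one hm]
  refine lintegral_congr fun x => ?_
  by_cases hx : ∃ i ≤ k, x i ∈ G.target
  · rw [if_pos hx, Set.indicator_of_mem (by exact hx)]
    rfl
  · rw [if_neg hx, Set.indicator_of_notMem (by exact hx), reachStep,
      if_neg fun hk => hx ⟨k, le_rfl, hk⟩]
    simp

instance (π₀ : G.Policy0) (π₁ : G.Policy1) (v : Fin G.n) :
    IsProbabilityMeasure (pathMeasure π₀ π₁ v) := by
  unfold pathMeasure; infer_instance

theorem tendsto_reachStep_iterate (π₀ : G.Policy0) (π₁ : G.Policy1) (v : Fin G.n) :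
    Filter.Tendsto (fun k => ((reachStep π₀ π₁)^[k] 0 v).toReal) Filter.atTop
      (nhds (reachProb π₀ π₁ v)) := by
  rw [← Filter.tendsto_add_atTop_iff_nat 1]
  simp only [← pathMeasure_hit_le]
  have hU : {x : ℕ → Fin G.n | ∃ i, x i ∈ G.target} = ⋃ k, {x | ∃ i ≤ k, x i ∈ G.target} := by
    ext x
    simp only [Set.mem_ofPred_eq, Set.mem_iUnion]
    exact ⟨fun ⟨i, hi⟩ => ⟨i, i, le_rfl, hi⟩, fun ⟨_, i, _, hi⟩ => ⟨i, hi⟩⟩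
  have hmono : Monotone fun k => {x : ℕ → Fin G.n | ∃ i ≤ k, x i ∈ G.target} :=
    fun k l hkl x ⟨i, hi, hx⟩ => ⟨i, hi.trans hkl, hx⟩
  unfold reachProb Measure.real
  rw [hU]
  exact (ENNReal.tendsto_toReal (measure_ne_top _ _)).comp
    (tendsto_measure_iUnion_atTop hmono)

theorem toReal_reachStep_iterate_le (π₀ : G.Policy0) (π₁ : G.Policy1) (v : Fin G.n) (k : ℕ) :
    ((reachStep π₀ π₁)^[k] 0 v).toReal ≤ reachProb π₀ π₁ v := by
  cases k with
  | zero => exact measureReal_nonneg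
  | succ k =>
    rw [← pathMeasure_hit_le]
    exact measureReal_mono fun x ⟨i, _, hx⟩ => ⟨i, hx⟩

/-! ### Value iteration -/

/-- The expected value of a function at the next vertex, under fixed policies. -/
noncomputable def expect (π₀ : G.Policy0) (π₁ : G.Policy1) (h : Fin G.n → ℝ) (v : Fin G.n) : ℝ :=
  ∑ w, (weight π₀ π₁ v w).toReal * h w

theorem weight_ne_top (π₀ : G.Policy0) (π₁ : G.Policy1) (v w : Fin G.n) :
    weight π₀ π₁ v w ≠ ∞ := by
  unfold weight
  split
  · split_ifs <;> simp
  · split_ifs <;> simp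
  · simp

theorem reachStep_iterate_ne_top (π₀ : G.Policy0) (π₁ : G.Policy1) (k : ℕ) (v : Fin G.n) :
    (reachStep π₀ π₁)^[k] 0 v ≠ ∞ := by
  cases k with
  | zero => simp
  | succ k =>
    rw [← pathMeasure_hit_le]
    exact measure_ne_top _ _

theorem toReal_reachStep_iterate_succ (π₀ : G.Policy0) (π₁ : G.Policy1) (k : ℕ) (v : Fin G.n) :
    ((reachStep π₀ π₁)^[k + 1] 0 v).toReal = if v ∈ G.target then 1 else
      expect π₀ π₁ (fun w => ((reachStep π₀ π₁)^[k] 0 w).toReal) v := by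
  rw [Function.iterate_succ_apply', reachStep]
  split_ifs
  · simp
  · rw [ENNReal.toReal_sum fun w _ =>
      ENNReal.mul_ne_top (weight_ne_top _ _ _ _) (reachStep_iterate_ne_top _ _ _ _)]
    simp [expect]

theorem sum_toReal_weight (π₀ : G.Policy0) (π₁ : G.Policy1) (v : Fin G.n) :
    ∑ w, (weight π₀ π₁ v w).toReal = 1 := by
  rw [← ENNReal.toReal_sum fun w _ => weight_ne_top _ _ _ _, sum_weight]
  simp

theorem expect_mono (π₀ : G.Policy0) (π₁ : G.Policy1) {g h : Fin G.n → ℝ} (hgh : ∀ w, g w ≤ h w)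
    (v : Fin G.n) : expect π₀ π₁ g v ≤ expect π₀ π₁ h v :=
  Finset.sum_le_sum fun w _ => mul_le_mul_of_nonneg_left (hgh w) ENNReal.toReal_nonneg

theorem expect_add_const (π₀ : G.Policy0) (π₁ : G.Policy1) (h : Fin G.n → ℝ) (c : ℝ)
    (v : Fin G.n) : expect π₀ π₁ (fun w => h w + c) v = expect π₀ π₁ h v + c := by
  simp only [expect, mul_add, Finset.sum_add_distrib, ← Finset.sum_mul, sum_toReal_weight, one_mul]

theorem expect_player0 (π₀ : G.Policy0) (π₁ : G.Policy1) (h : Fin G.n → ℝ) {v : Fin G.n}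
    {S : Finset (Fin G.n)} (hv : G.node v = .player0 S) :
    expect π₀ π₁ h v = h (π₀.1 v) := by
  simp [expect, weight, hv, apply_ite ENNReal.toReal]

theorem expect_player1 (π₀ : G.Policy0) (π₁ : G.Policy1) (h : Fin G.n → ℝ) {v : Fin G.n}
    {S : Finset (Fin G.n)} (hv : G.node v = .player1 S) :
    expect π₀ π₁ h v = h (π₁.1 v) := by
  simp [expect, weight, hv, apply_ite ENNReal.toReal]

theorem expect_random (π₀ : G.Policy0) (π₁ : G.Policy1) (h : Fin G.n → ℝ) {v : Fin G.n}
    {δ : Fin G.n → ℚ≥0} (hv : G.node v = .random δ) :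
    expect π₀ π₁ h v = ∑ w, (δ w : ℝ) * h w := by
  simp only [expect, weight, hv, ENNReal.coe_toReal]
  exact Finset.sum_congr rfl fun w _ => by norm_cast

variable (G) in
/-- The one-step operator when Player 0 maximizes and Player 1 minimizes. -/
noncomputable def optimize (h : Fin G.n → ℝ) (v : Fin G.n) : ℝ :=
  match G.node v with
  | .player0 S => ⨆ w : S, h w
  | .player1 S => ⨅ w : S, h w
  | .random δ => ∑ w, (δ w : ℝ) * h w

variable (G) in
/-- The value of the game in which the target has to be reached within `k - 1` steps. -/
noncomputable def iterValue : ℕ → Fin G.n → ℝ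
  | 0, _ => 0
  | k + 1, v => if v ∈ G.target then 1 else G.optimize (iterValue k) v

theorem le_optimize_player0 {v : Fin G.n} {S : Finset (Fin G.n)} (hv : G.node v = .player0 S)
    (h : Fin G.n → ℝ) {w : Fin G.n} (hw : w ∈ S) : h w ≤ G.optimize h v := by
  rw [optimize, hv]
  exact le_ciSup (f := fun w : S => h w) (Set.finite_range _).bddAbove ⟨w, hw⟩

theorem optimize_player1_le {v : Fin G.n} {S : Finset (Fin G.n)} (hv : G.node v = .player1 S)
    (h : Fin G.n → ℝ) {w : Fin G.n} (hw : w ∈ S) : G.optimize h v ≤ h w := by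
  rw [optimize, hv]
  exact ciInf_le (f := fun w : S => h w) (Set.finite_range _).bddBelow ⟨w, hw⟩

theorem exists_eq_optimize_player0 {v : Fin G.n} {S : Finset (Fin G.n)}
    (hv : G.node v = .player0 S) (h : Fin G.n → ℝ) : ∃ w ∈ S, h w = G.optimize h v := by
  have hS : S.Nonempty := by simpa [hv, SSGNode.succ] using G.player_nonempty v (.inl ⟨S, hv⟩)
  have := hS.to_subtype
  obtain ⟨w, hw⟩ := exists_eq_ciSup_of_finite (f := fun w : S => h w)
  rw [optimize, hv]
  exact ⟨w, w.2, hw⟩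

theorem exists_eq_optimize_player1 {v : Fin G.n} {S : Finset (Fin G.n)}
    (hv : G.node v = .player1 S) (h : Fin G.n → ℝ) : ∃ w ∈ S, h w = G.optimize h v := by
  have hS : S.Nonempty := by simpa [hv, SSGNode.succ] using G.player_nonempty v (.inr ⟨S, hv⟩)
  have := hS.to_subtype
  obtain ⟨w, hw⟩ := exists_eq_ciInf_of_finite (f := fun w : S => h w)
  rw [optimize, hv]
  exact ⟨w, w.2, hw⟩

theorem optimize_random {v : Fin G.n} {δ : Fin G.n → ℚ≥0} (hv : G.node v = .random δ)
    (h : Fin G.n → ℝ) : G.optimize h v = ∑ w, (δ w : ℝ) * h w := by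
  rw [optimize, hv]

variable (G) in
/-- A policy of Player 0 that maximizes a given function in one step. -/
theorem exists_policy0_optimize_le (h : Fin G.n → ℝ) :
    ∃ π₀ : G.Policy0, ∀ π₁ v, G.optimize h v ≤ expect π₀ π₁ h v := by
  have hex : ∀ v, ∃ w, (G.node v).IsPlayer0 → w ∈ (G.node v).succ ∧ h w = G.optimize h v := by
    intro v
    by_cases hv : (G.node v).IsPlayer0
    · obtain ⟨S, hS⟩ := hv
      obtain ⟨w, hw, he⟩ := exists_eq_optimize_player0 hS h
      exact ⟨w, fun _ => ⟨by rwa [hS], he⟩⟩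
    · exact ⟨v, fun h => absurd h hv⟩
  choose π hπ using hex
  obtain ⟨π₀, rfl⟩ : ∃ π₀ : G.Policy0, π₀.1 = π := ⟨⟨π, fun v hv => (hπ v hv).1⟩, rfl⟩
  refine ⟨π₀, fun π₁ v => ?_⟩
  cases hv : G.node v with
  | player0 S => rw [expect_player0 _ _ _ hv, ← (hπ v ⟨S, hv⟩).2]
  | player1 S =>
    rw [expect_player1 _ _ _ hv]
    exact optimize_player1_le hv h (by simpa [hv, SSGNode.succ] using π₁.2 v ⟨S, hv⟩)
  | random δ => rw [expect_random _ _ _ hv, optimize_random hv]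

variable (G) in
/-- A policy of Player 1 that minimizes a given function in one step. -/
theorem exists_policy1_le_optimize (h : Fin G.n → ℝ) :
    ∃ π₁ : G.Policy1, ∀ π₀ v, expect π₀ π₁ h v ≤ G.optimize h v := by
  have hex : ∀ v, ∃ w, (G.node v).IsPlayer1 → w ∈ (G.node v).succ ∧ h w = G.optimize h v := by
    intro v
    by_cases hv : (G.node v).IsPlayer1
    · obtain ⟨S, hS⟩ := hv
      obtain ⟨w, hw, he⟩ := exists_eq_optimize_player1 hS h
      exact ⟨w, fun _ => ⟨by rwa [hS], he⟩⟩
    · exact ⟨v, fun h => absurd h hv⟩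
  choose π hπ using hex
  obtain ⟨π₁, rfl⟩ : ∃ π₁ : G.Policy1, π₁.1 = π := ⟨⟨π, fun v hv => (hπ v hv).1⟩, rfl⟩
  refine ⟨π₁, fun π₀ v => ?_⟩
  cases hv : G.node v with
  | player0 S =>
    rw [expect_player0 _ _ _ hv]
    exact le_optimize_player0 hv h (by simpa [hv, SSGNode.succ] using π₀.2 v ⟨S, hv⟩)
  | player1 S => rw [expect_player1 _ _ _ hv, ← (hπ v ⟨S, hv⟩).2]
  | random δ => rw [expect_random _ _ _ hv, optimize_random hv]

/-! ### Value iteration computes the value -/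

theorem sum_dist {v : Fin G.n} {δ : Fin G.n → ℚ≥0} (hv : G.node v = .random δ) :
    ∑ w, (δ w : ℝ) = 1 := by
  exact_mod_cast congrArg (fun q : ℚ≥0 => (q : ℝ)) (G.random_sum v δ hv)

/-- Maxima, minima and averages are monotone and commute with adding a constant. This carries
uniform approximations through one step. -/
theorem optimize_le_add {g h : Fin G.n → ℝ} {c : ℝ} (hgh : ∀ w, g w ≤ h w + c) (v : Fin G.n) :
    G.optimize g v ≤ G.optimize h v + c := by
  cases hv : G.node v with
  | player0 S =>
    obtain ⟨w, hw, he⟩ := exists_eq_optimize_player0 hv g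
    linarith [hgh w, le_optimize_player0 hv h hw]
  | player1 S =>
    obtain ⟨w, hw, he⟩ := exists_eq_optimize_player1 hv h
    linarith [hgh w, optimize_player1_le hv g hw]
  | random δ =>
    rw [optimize_random hv, optimize_random hv]
    calc ∑ w, (δ w : ℝ) * g w ≤ ∑ w, (δ w : ℝ) * (h w + c) :=
          Finset.sum_le_sum fun w _ => mul_le_mul_of_nonneg_left (hgh w) (by positivity)
      _ = _ := by
          simp only [mul_add, Finset.sum_add_distrib, ← Finset.sum_mul, sum_dist hv, one_mul]

theorem optimize_mono {g h : Fin G.n → ℝ} (hgh : ∀ w, g w ≤ h w) (v : Fin G.n) :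
    G.optimize g v ≤ G.optimize h v := by
  simpa using optimize_le_add (c := 0) (by simpa using hgh) v

theorem optimize_const (c : ℝ) (v : Fin G.n) : G.optimize (fun _ => c) v = c := by
  cases hv : G.node v with
  | player0 S =>
    obtain ⟨w, -, he⟩ := exists_eq_optimize_player0 hv fun _ => c
    exact he.symm
  | player1 S =>
    obtain ⟨w, -, he⟩ := exists_eq_optimize_player1 hv fun _ => c
    exact he.symm
  | random δ => rw [optimize_random hv, ← Finset.sum_mul, sum_dist hv, one_mul]

theorem optimize_mul {c : ℝ} (hc : 0 ≤ c) (h : Fin G.n → ℝ) (v : Fin G.n) :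
    G.optimize (fun w => c * h w) v = c * G.optimize h v := by
  unfold optimize
  split
  · rw [Real.mul_iSup_of_nonneg hc]
  · rw [Real.mul_iInf_of_nonneg hc]
  · rw [Finset.mul_sum]
    exact Finset.sum_congr rfl fun w _ => by ring

theorem iterValue_nonneg (k : ℕ) (v : Fin G.n) : 0 ≤ G.iterValue k v := by
  induction k generalizing v with
  | zero => exact le_rfl
  | succ k ih =>
    rw [iterValue]
    split_ifs
    · exact zero_le_one
    · exact (optimize_const (G := G) 0 v).symm.le.trans (optimize_mono ih v)

theorem iterValue_le_one (k : ℕ) (v : Fin G.n) : G.iterValue k v ≤ 1 := by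
  induction k generalizing v with
  | zero => exact zero_le_one
  | succ k ih =>
    rw [iterValue]
    split_ifs
    · exact le_rfl
    · exact (optimize_mono ih v).trans (optimize_const (G := G) 1 v).le

theorem iterValue_le_succ (k : ℕ) (v : Fin G.n) : G.iterValue k v ≤ G.iterValue (k + 1) v := by
  induction k generalizing v with
  | zero => exact iterValue_nonneg 1 v
  | succ k ih =>
    rw [iterValue, iterValue]
    split_ifs
    · exact le_rfl
    · exact optimize_mono ih v

variable (G) in
/-- The limit of value iteration. -/
noncomputable def limValue (v : Fin G.n) : ℝ := ⨆ k, G.iterValue k v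

theorem bddAbove_iterValue (v : Fin G.n) : BddAbove (Set.range fun k => G.iterValue k v) :=
  ⟨1, by rintro _ ⟨k, rfl⟩; exact iterValue_le_one k v⟩

theorem iterValue_le_limValue (k : ℕ) (v : Fin G.n) : G.iterValue k v ≤ G.limValue v :=
  le_ciSup (bddAbove_iterValue v) k

theorem limValue_le_iff {v : Fin G.n} {c : ℝ} : G.limValue v ≤ c ↔ ∀ k, G.iterValue k v ≤ c :=
  ciSup_le_iff (bddAbove_iterValue v)

theorem limValue_nonneg (v : Fin G.n) : 0 ≤ G.limValue v := iterValue_le_limValue 0 v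

theorem limValue_of_mem_target {v : Fin G.n} (hv : v ∈ G.target) : 1 ≤ G.limValue v := by
  simpa [iterValue, hv] using iterValue_le_limValue 1 v

/-- There are finitely many vertices, so a single iterate is within `ε` of the limit at all of them;
one further step then changes the bound by at most `ε`. -/
theorem optimize_limValue_le {v : Fin G.n} (hv : v ∉ G.target) :
    G.optimize G.limValue v ≤ G.limValue v := by
  refine le_of_forall_pos_le_add fun ε hε => ?_
  have h : ∀ w, ∀ᶠ k in Filter.atTop, G.limValue w ≤ G.iterValue k w + ε := by
    intro w
    have := (tendsto_atTop_ciSup (monotone_nat_of_le_succ fun k => iterValue_le_succ k w)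
      (bddAbove_iterValue w)).eventually_const_lt (sub_lt_self (G.limValue w) hε)
    filter_upwards [this] with k hk
    linarith
  obtain ⟨k, hk⟩ := (Filter.eventually_all.2 h).exists
  have h1 := optimize_le_add hk v
  have h2 := iterValue_le_limValue (k + 1) v
  rw [iterValue, if_neg hv] at h2
  linarith

variable (G) in
/-- Player 1 has a policy that limits the probability of reaching the target to the limit of value
iteration. -/
theorem exists_policy1_reachProb_le :
    ∃ π₁ : G.Policy1, ∀ π₀ v, reachProb π₀ π₁ v ≤ G.limValue v := by
  -- Under the greedy policy for the limit, `limValue` is superharmonic off the target and at least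
  -- 1 on it, so it dominates all reachability probabilities with bounded horizon.
  obtain ⟨π₁, hπ₁⟩ := G.exists_policy1_le_optimize G.limValue
  refine ⟨π₁, fun π₀ v => le_of_tendsto' (tendsto_reachStep_iterate π₀ π₁ v) fun k => ?_⟩
  induction k generalizing v with
  | zero => exact limValue_nonneg v
  | succ k ih =>
    rw [toReal_reachStep_iterate_succ]
    split_ifs with hv
    · exact limValue_of_mem_target hv
    · exact (expect_mono π₀ π₁ ih v).trans ((hπ₁ π₀ v).trans (optimize_limValue_le hv))

variable (G) in
/-- Player 0 has a policy that guarantees any discounted value of a game with bounded horizon. -/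
theorem exists_policy0_le_reachProb {c : ℝ} (hc₀ : 0 ≤ c) (hc₁ : c < 1) :
    ∃ π₀ : G.Policy0, ∀ π₁ v k, c ^ k * G.iterValue k v ≤ reachProb π₀ π₁ v := by
  -- The discount penalizes delay: off the target `h ≤ c * optimize h` (`hstep`), so postponing for
  -- ever cannot keep up the value of `h`.
  let h : Fin G.n → ℝ := fun v => ⨆ k, c ^ k * G.iterValue k v
  have hle : ∀ k v, c ^ k * G.iterValue k v ≤ 1 := fun k v =>
    mul_le_one₀ (pow_le_one₀ hc₀ hc₁.le) (iterValue_nonneg k v) (iterValue_le_one k v)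
  have hbdd : ∀ v, BddAbove (Set.range fun k => c ^ k * G.iterValue k v) := fun v =>
    ⟨1, by rintro _ ⟨k, rfl⟩; exact hle k v⟩
  have hh : ∀ k v, c ^ k * G.iterValue k v ≤ h v := fun k v => le_ciSup (hbdd v) k
  have hh1 : ∀ v, h v ≤ 1 := fun v => ciSup_le fun k => hle k v
  have hstep : ∀ v, h v ≤ c * if v ∈ G.target then 1 else G.optimize h v := by
    intro v
    have h0 : 0 ≤ if v ∈ G.target then (1 : ℝ) else G.optimize h v := by
      split_ifs
      · exact zero_le_one
      · refine (optimize_const (G := G) 0 v).symm.le.trans (optimize_mono (fun w => ?_) v)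
        simpa [iterValue] using hh 0 w
    refine ciSup_le fun k => ?_
    cases k with
    | zero => simpa [iterValue] using mul_nonneg hc₀ h0
    | succ k =>
      rw [pow_succ', mul_assoc, iterValue]
      refine mul_le_mul_of_nonneg_left ?_ hc₀
      split_ifs
      · simpa using pow_le_one₀ hc₀ hc₁.le
      · rw [← optimize_mul (pow_nonneg hc₀ k)]
        exact optimize_mono (hh k) v
  obtain ⟨π₀, hπ₀⟩ := G.exists_policy0_optimize_le h
  -- Under the greedy policy for `h`, the part of `h` not yet realized after `k` steps shrinks by
  -- the factor `c` per step, hence the error `c ^ k`.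
  have hk : ∀ π₁ k v, h v ≤ ((reachStep π₀ π₁)^[k] 0 v).toReal + c ^ k := by
    intro π₁ k
    induction k with
    | zero => intro v; simpa using hh1 v
    | succ k ih =>
      intro v
      have h1 := hstep v
      rw [toReal_reachStep_iterate_succ]
      have hck : 0 ≤ c ^ (k + 1) := pow_nonneg hc₀ _
      split_ifs at h1 ⊢
      · linarith
      · have h2 := (hπ₀ π₁ v).trans (expect_mono π₀ π₁ ih v)
        rw [expect_add_const] at h2
        set e := expect π₀ π₁ (fun w => ((reachStep π₀ π₁)^[k] 0 w).toReal) v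
        have he : 0 ≤ e := Finset.sum_nonneg fun w _ =>
          mul_nonneg ENNReal.toReal_nonneg ENNReal.toReal_nonneg
        have h3 := mul_le_mul_of_nonneg_left h2 hc₀
        rw [pow_succ']
        nlinarith
  refine ⟨π₀, fun π₁ v k => (hh k v).trans ?_⟩
  refine ge_of_tendsto' (x := Filter.atTop) (f := fun k : ℕ => reachProb π₀ π₁ v + c ^ k) ?_
    fun k => (hk π₁ k v).trans (by gcongr; exact toReal_reachStep_iterate_le π₀ π₁ v k)
  simpa using (tendsto_pow_atTop_nhds_zero_of_lt_one hc₀ hc₁).const_add (reachProb π₀ π₁ v)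

theorem isGreatest_guaranteed (v : Fin G.n) : IsGreatest (G.guaranteed v) (G.limValue v) := by
  have : Finite G.Policy0 := Subtype.finite
  obtain ⟨π₁, hπ₁⟩ := G.exists_policy1_reachProb_le
  have : Nonempty G.Policy1 := ⟨π₁⟩
  have : Finite G.Policy1 := Subtype.finite
  have : Nonempty G.Policy0 := ⟨(G.exists_policy0_optimize_le 0).choose⟩
  have hbdd : ∀ π₀ : G.Policy0, BddBelow (Set.range fun π₁ => reachProb π₀ π₁ v) :=
    fun π₀ => (Set.finite_range _).bddBelow
  -- The best policy for `v` does not depend on `c`, unlike the discounted ones. It is at least as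
  -- good as each of them, so `c` can tend to 1.
  obtain ⟨π₀, hπ₀⟩ := Finite.exists_max fun π₀ : G.Policy0 => ⨅ π₁, reachProb π₀ π₁ v
  constructor
  · refine ⟨π₀, fun π₁ => le_trans ?_ (ciInf_le (hbdd π₀) π₁)⟩
    refine limValue_le_iff.2 fun k => ?_
    refine le_of_tendsto (x := nhdsWithin (1 : ℝ) (Set.Iio 1))
      (f := fun c => c ^ k * G.iterValue k v) ?_ ?_
    · have : Continuous fun c : ℝ => c ^ k * G.iterValue k v := by fun_prop
      simpa using (this.tendsto 1).mono_left nhdsWithin_le_nhds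
    · filter_upwards [Ioo_mem_nhdsLT (zero_lt_one' ℝ)] with c hc
      obtain ⟨π₀', h⟩ := G.exists_policy0_le_reachProb hc.1.le hc.2
      exact (le_ciInf fun π₁ => h π₁ v k).trans (hπ₀ π₀')
  · rintro p ⟨π₀', hp⟩
    exact (hp π₁).trans (hπ₁ π₀' v)

theorem value_eq_limValue (v : Fin G.n) : G.value v = G.limValue v :=
  (isGreatest_guaranteed v).csSup_eq

end SSG

/-! ### Safety values of bidding games -/

theorem Node.sum_succ_random {n : ℕ} (δ : Fin n → ℚ≥0) (p : Fin n → ℝ) :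
    ∑ w ∈ (Node.random δ).succ, (δ w : ℝ) * p w = ∑ w, (δ w : ℝ) * p w := by
  rw [Node.succ, Finset.sum_filter_of_ne]
  intro w _ hw
  refine pos_iff_ne_zero.2 fun h => hw ?_
  simp [h]

namespace BiddingGame

variable {M : BiddingGame}

theorem sum_dist {v : Fin M.n} {δ : Fin M.n → ℚ≥0} (hv : M.node v = .random δ) :
    ∑ w, (δ w : ℝ) = 1 := by
  exact_mod_cast congrArg (fun q : ℚ≥0 => (q : ℝ)) (M.random_sum v δ hv)

theorem mem_bellman_control {val : Fin M.n → Set (ℝ × ℝ)} {v : Fin M.n} {S : Finset (Fin M.n)}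
    (hv : M.node v = .control S) {B p : ℝ} :
    (B, p) ∈ M.bellman val v ↔ p ∈ Set.Icc (0 : ℝ) 1 ∧ ∃ Bminus Bplus : ℝ,
      (∃ w ∈ S, (Bminus, p) ∈ val w) ∧ (∀ w ∈ S, (Bplus, p) ∈ val w) ∧
        B = (Bplus + Bminus) / 2 := by
  unfold bellman
  split
  · simp_all
  · rename_i S' hS'
    rw [hv] at hS'
    cases hS'
    constructor
    · rintro ⟨q, hq, b, b', h1, h2, h3⟩
      cases h3
      exact ⟨hq, b, b', h1, h2, rfl⟩
    · rintro ⟨hp, b, b', h1, h2, rfl⟩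
      exact ⟨p, hp, b, b', h1, h2, rfl⟩

theorem mem_bellman_random {val : Fin M.n → Set (ℝ × ℝ)} {v : Fin M.n} {δ : Fin M.n → ℚ≥0}
    (hv : M.node v = .random δ) {B p : ℝ} :
    (B, p) ∈ M.bellman val v ↔ B ∈ Set.Icc (0 : ℝ) 1 ∧ ∃ q : Fin M.n → ℝ,
      (∀ w, 0 < δ w → (B, q w) ∈ val w) ∧ p = ∑ w, (δ w : ℝ) * q w := by
  unfold bellman
  split
  · rename_i δ' hδ'
    have hs : ∀ q : Fin M.n → ℝ, ∑ w ∈ (M.node v).succ, (δ' w : ℝ) * q w = ∑ w, (δ w : ℝ) * q w := by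
      intro q
      rw [hδ'] at hv
      cases hv
      rw [hδ', Node.sum_succ_random]
    have hm : ∀ w, w ∈ (M.node v).succ ↔ 0 < δ w := by simp [hv, Node.succ]
    simp only [hs, hm]
    constructor
    · rintro ⟨b, hb, q, h1, h2⟩
      cases h2
      exact ⟨hb, q, h1, rfl⟩
    · rintro ⟨hb, q, h1, rfl⟩
      exact ⟨B, hb, q, h1, rfl⟩
  · simp_all

theorem sval_zero_of_notMem {v : Fin M.n} (hv : v ∉ M.target) :
    M.sval 0 v = Set.Icc (0 : ℝ) 1 ×ˢ Set.Icc (0 : ℝ) 1 := if_neg hv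

theorem mem_Icc_of_mem_sval {i : ℕ} {v : Fin M.n} {B p : ℝ} (h : (B, p) ∈ M.sval i v) :
    B ∈ Set.Icc (0 : ℝ) 1 ∧ p ∈ Set.Icc (0 : ℝ) 1 := by
  induction i generalizing v B p with
  | zero =>
    rw [sval] at h
    split_ifs at h
    · rcases h with ⟨h1, h2⟩ | ⟨h1, h2⟩
      · rw [Set.mem_singleton_iff] at h2
        exact ⟨h1, by simp [show p = 1 from h2]⟩
      · rw [Set.mem_singleton_iff] at h1
        exact ⟨by simp [show B = 0 from h1], h2⟩
    · exact h
  | succ i ih =>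
    rw [sval] at h
    cases hv : M.node v with
    | control S =>
      obtain ⟨hp, b, b', ⟨w, hw, h1⟩, h2, rfl⟩ := (mem_bellman_control hv).1 h
      obtain ⟨h3, h4⟩ := (ih h1).1
      obtain ⟨h5, h6⟩ := (ih (h2 w hw)).1
      exact ⟨⟨by linarith, by linarith⟩, hp⟩
    | random δ =>
      obtain ⟨hB, q, h1, rfl⟩ := (mem_bellman_random hv).1 h
      have hq : ∀ w, 0 ≤ (δ w : ℝ) * q w ∧ (δ w : ℝ) * q w ≤ δ w := by
        intro w
        rcases eq_or_ne (δ w) 0 with h0 | h0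
        · simp [h0]
        · obtain ⟨h2, h3⟩ := (ih (h1 w (pos_iff_ne_zero.2 h0))).2
          have : (0 : ℝ) ≤ δ w := by positivity
          exact ⟨mul_nonneg this h2, mul_le_of_le_one_right this h3⟩
      refine ⟨hB, Finset.sum_nonneg fun w _ => (hq w).1, ?_⟩
      rw [← sum_dist hv]
      exact Finset.sum_le_sum fun w _ => (hq w).2

/-- Take `Bminus = Bplus = B` at a control vertex and a constant probability at a random one. This
preserves the trivial pairs, those with budget 0 or probability 1. -/
theorem mem_sval_succ_of_forall {i : ℕ} {v : Fin M.n} {B p : ℝ} (hB : B ∈ Set.Icc (0 : ℝ) 1)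
    (hp : p ∈ Set.Icc (0 : ℝ) 1) (h : ∀ w, (B, p) ∈ M.sval i w) : (B, p) ∈ M.sval (i + 1) v := by
  rw [sval]
  cases hv : M.node v with
  | control S =>
    obtain ⟨w, hw⟩ := M.control_nonempty v S hv
    exact (mem_bellman_control hv).2 ⟨hp, B, B, ⟨w, hw, h w⟩, fun w _ => h w, by ring⟩
  | random δ =>
    refine (mem_bellman_random hv).2 ⟨hB, fun _ => p, fun w _ => h w, ?_⟩
    rw [← Finset.sum_mul, sum_dist hv, one_mul]

theorem zero_mem_sval (i : ℕ) (v : Fin M.n) {p : ℝ} (hp : p ∈ Set.Icc (0 : ℝ) 1) :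
    (0, p) ∈ M.sval i v := by
  induction i generalizing v with
  | zero =>
    rw [sval]
    split_ifs
    · exact .inr ⟨rfl, hp⟩
    · exact ⟨by simp, hp⟩
  | succ i ih => exact mem_sval_succ_of_forall (by simp) hp ih

theorem mem_sval_one (i : ℕ) (v : Fin M.n) {B : ℝ} (hB : B ∈ Set.Icc (0 : ℝ) 1) :
    (B, 1) ∈ M.sval i v := by
  induction i generalizing v with
  | zero =>
    rw [sval]
    split_ifs
    · exact .inl ⟨hB, rfl⟩
    · exact ⟨hB, by simp⟩
  | succ i ih => exact mem_sval_succ_of_forall hB (by simp) ih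

/-- The initial sets are stable under shrinking the budget, and averaging two budgets is linear.
Scaling avoids a case distinction on how to split a smaller budget. -/
theorem mul_mem_sval {i : ℕ} {v : Fin M.n} {B p c : ℝ} (hc : c ∈ Set.Icc (0 : ℝ) 1)
    (h : (B, p) ∈ M.sval i v) : (c * B, p) ∈ M.sval i v := by
  induction i generalizing v B p with
  | zero =>
    rw [sval] at h ⊢
    have key : ∀ b ∈ Set.Icc (0 : ℝ) 1, c * b ∈ Set.Icc (0 : ℝ) 1 := fun b hb =>
      ⟨mul_nonneg hc.1 hb.1, mul_le_one₀ hc.2 hb.1 hb.2⟩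
    split_ifs at h ⊢
    · rcases h with ⟨h1, h2⟩ | ⟨h1, h2⟩
      · exact .inl ⟨key _ h1, h2⟩
      · refine .inr ⟨?_, h2⟩
        rw [Set.mem_singleton_iff] at h1 ⊢
        simp [show B = 0 from h1]
    · exact ⟨key _ h.1, h.2⟩
  | succ i ih =>
    have hB := (mem_Icc_of_mem_sval h).1
    rw [sval] at h ⊢
    cases hv : M.node v with
    | control S =>
      obtain ⟨hp, b, b', ⟨w, hw, h1⟩, h2, rfl⟩ := (mem_bellman_control hv).1 h
      exact (mem_bellman_control hv).2
        ⟨hp, c * b, c * b', ⟨w, hw, ih h1⟩, fun w hw => ih (h2 w hw), by ring⟩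
    | random δ =>
      obtain ⟨-, q, h1, rfl⟩ := (mem_bellman_random hv).1 h
      exact (mem_bellman_random hv).2 ⟨⟨mul_nonneg hc.1 hB.1, mul_le_one₀ hc.2 hB.1 hB.2⟩, q,
        fun w hw => ih (h1 w hw), rfl⟩

theorem mem_sval_of_le {i : ℕ} {v : Fin M.n} {B B' p : ℝ} (h0 : 0 ≤ B') (hle : B' ≤ B)
    (h : (B, p) ∈ M.sval i v) : (B', p) ∈ M.sval i v := by
  rcases (h0.trans hle).eq_or_lt with h1 | h1
  · rwa [show B' = B by linarith]
  · have := mul_mem_sval (c := B' / B) ⟨by positivity, (div_le_one h1).2 hle⟩ h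
    rwa [div_mul_cancel₀ _ h1.ne'] at this

theorem mem_sval_target_sink {v : Fin M.n} (hv : M.node v = .control {v}) (hT : v ∈ M.target)
    {i : ℕ} {B p : ℝ} (h : (B, p) ∈ M.sval i v) : B = 0 ∨ p = 1 := by
  induction i generalizing B with
  | zero =>
    rw [sval, if_pos hT] at h
    exact h.symm.imp (fun h => h.1) fun h => h.2
  | succ i ih =>
    rw [sval, mem_bellman_control hv] at h
    obtain ⟨-, b, b', ⟨w, hw, h1⟩, h2, rfl⟩ := h
    rw [Finset.mem_singleton] at hw
    subst hw
    rcases ih h1 with h3 | h3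
    · rcases ih (h2 w (by simp)) with h4 | h4
      · exact .inl (by rw [h3, h4]; norm_num)
      · exact .inr h4
    · exact .inr h3

theorem mem_sval_safe_sink {v : Fin M.n} (hv : M.node v = .control {v}) (hT : v ∉ M.target)
    (i : ℕ) {B p : ℝ} (hB : B ∈ Set.Icc (0 : ℝ) 1) (hp : p ∈ Set.Icc (0 : ℝ) 1) :
    (B, p) ∈ M.sval i v := by
  induction i with
  | zero =>
    rw [sval, if_neg hT]
    exact ⟨hB, hp⟩
  | succ i ih =>
    rw [sval, mem_bellman_control hv]
    exact ⟨hp, B, B, ⟨v, by simp, ih⟩, by simpa using ih, by ring⟩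

end BiddingGame

namespace SSG

variable {G : SSG}

/-! ### Phases of a simple stochastic game -/

/-- Without dead ends every finite path extends to an infinite one, so a condition on infinite paths
constrains each vertex reached. -/
theorem exists_mem_succ (G : SSG) (v : Fin G.n) : ∃ w, w ∈ (G.node v).succ := by
  cases hv : G.node v with
  | player0 S => exact hv ▸ G.player_nonempty v (.inl ⟨S, hv⟩)
  | player1 S => exact hv ▸ G.player_nonempty v (.inr ⟨S, hv⟩)
  | random δ =>
    by_contra! h
    have h0 : ∀ w, δ w = 0 := by simpa [SSGNode.succ] using h
    simpa [h0] using G.random_sum v δ hv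

/-- The kind of the vertices that are visited in a given step. -/
def HasPhase {n : ℕ} (x : SSGNode n) (j : ℕ) : Prop :=
  (j % 4 = 0 → x.IsPlayer1) ∧ (j % 4 = 1 → x.IsRandom) ∧ (j % 4 = 2 → x.IsPlayer0) ∧
    (j % 4 = 3 → x.IsRandom)

variable (G) in
/-- Every infinite path from a vertex visits vertices of the kinds prescribed from step `j` on. -/
def Alternates (j : ℕ) (v : Fin G.n) : Prop :=
  ∀ path : ℕ → Fin G.n, path 0 = v → (∀ i, path (i + 1) ∈ (G.node (path i)).succ) →
    ∀ i, HasPhase (G.node (path i)) (j + i)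

theorem alternates_init (G : SSG) : G.Alternates 0 G.init := by
  intro path h0 hs i
  obtain ⟨h1, h2, h3, h4⟩ := G.alternating path h0 hs (i / 4)
  have hi : ∀ r, (0 + i) % 4 = r → 4 * (i / 4) + r = i := by omega
  refine ⟨fun h => ?_, fun h => ?_, fun h => ?_, fun h => ?_⟩
  · rwa [← Nat.add_zero (4 * (i / 4)), hi 0 h] at h1
  · rwa [hi 1 h] at h2
  · rwa [hi 2 h] at h3
  · rwa [hi 3 h] at h4

theorem Alternates.succ {j : ℕ} {v w : Fin G.n} (h : G.Alternates j v)
    (hw : w ∈ (G.node v).succ) : G.Alternates (j + 1) w := by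
  intro path h0 hs i
  -- The given path is prolonged backwards by `v`.
  have := h (fun i => Nat.casesOn i v path) rfl (fun i => by
    cases i with
    | zero => simpa [h0] using hw
    | succ i => exact hs i) (i + 1)
  rwa [show j + 1 + i = j + (i + 1) by omega]

theorem Alternates.hasPhase {j : ℕ} {v : Fin G.n} (h : G.Alternates j v) :
    HasPhase (G.node v) j := by
  choose f hf using G.exists_mem_succ
  exact h (fun i => f^[i] v) rfl (fun i => by
    rw [Function.iterate_succ_apply']
    exact hf _) 0

/-- The budget in step `j`. -/
noncomputable def budget (j : ℕ) : ℝ := if j % 4 = 0 ∨ j % 4 = 3 then 1 / 3 else 2 / 3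

theorem budget_mem_Icc (j : ℕ) : budget j ∈ Set.Icc (0 : ℝ) 1 := by
  unfold budget
  split_ifs <;> constructor <;> norm_num

theorem budget_pos (j : ℕ) : 0 < budget j := by
  unfold budget
  split_ifs <;> norm_num

theorem budget_of_player1 {j : ℕ} {v : Fin G.n} {S : Finset (Fin G.n)} (h : G.Alternates j v)
    (hv : G.node v = .player1 S) : budget j = 1 / 3 ∧ budget (j + 1) = 2 / 3 := by
  obtain ⟨h0, h1, h2, h3⟩ := h.hasPhase
  simp only [hv, SSGNode.IsPlayer0, SSGNode.IsRandom, reduceCtorEq, exists_false, imp_false]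
    at h1 h2 h3
  unfold budget
  rw [if_pos (by omega), if_neg (by omega)]
  exact ⟨rfl, rfl⟩

theorem budget_of_player0 {j : ℕ} {v : Fin G.n} {S : Finset (Fin G.n)} (h : G.Alternates j v)
    (hv : G.node v = .player0 S) : budget j = 2 / 3 ∧ budget (j + 1) = 1 / 3 := by
  obtain ⟨h0, h1, h2, h3⟩ := h.hasPhase
  simp only [hv, SSGNode.IsPlayer1, SSGNode.IsRandom, reduceCtorEq, exists_false, imp_false]
    at h0 h1 h3
  unfold budget
  rw [if_neg (by omega), if_pos (by omega)]
  exact ⟨rfl, rfl⟩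

theorem budget_of_random {j : ℕ} {v : Fin G.n} {δ : Fin G.n → ℚ≥0} (h : G.Alternates j v)
    (hv : G.node v = .random δ) : budget (j + 1) = budget j := by
  obtain ⟨h0, h1, h2, h3⟩ := h.hasPhase
  simp only [hv, SSGNode.IsPlayer1, SSGNode.IsPlayer0, reduceCtorEq, exists_false, imp_false]
    at h0 h2
  unfold budget
  congr 1
  rw [eq_iff_iff]
  omega

/-! ### Safety values of the reduction -/

theorem sval_toBiddingGame_zero {i : ℕ} {B p : ℝ}
    (h : (B, p) ∈ G.toBiddingGame.sval i (0 : Fin (G.n + 2))) : B = 0 ∨ p = 1 :=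
  BiddingGame.mem_sval_target_sink (M := G.toBiddingGame) (v := (0 : Fin (G.n + 2))) rfl
    (Finset.mem_singleton_self _) h

theorem sval_toBiddingGame_one (i : ℕ) {B p : ℝ} (hB : B ∈ Set.Icc (0 : ℝ) 1)
    (hp : p ∈ Set.Icc (0 : ℝ) 1) :
    (B, p) ∈ G.toBiddingGame.sval i (1 : Fin (G.n + 2)) :=
  BiddingGame.mem_sval_safe_sink (M := G.toBiddingGame) (v := (1 : Fin (G.n + 2))) rfl
    (by change (1 : Fin (G.n + 2)) ∉ ({0} : Finset (Fin (G.n + 2))); simp) i hB hp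

theorem shift_notMem_target (v : Fin G.n) : shift v ∉ G.toBiddingGame.target := by
  change shift v ∉ ({0} : Finset (Fin (G.n + 2)))
  rw [Finset.mem_singleton]
  exact Fin.succ_ne_zero _

theorem toBiddingGame_node_shift_of_mem {v : Fin G.n} (hv : v ∈ G.target) :
    G.toBiddingGame.node (shift v) = .control ({0} : Finset (Fin (G.n + 2))) :=
  if_pos hv

theorem toBiddingGame_node_shift {v : Fin G.n} (hv : v ∉ G.target) :
    G.toBiddingGame.node (shift v) = (G.node v).toNode :=
  if_neg hv

/-- Reaching the target is forced with a positive budget at the vertex of a target. -/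
theorem mem_sval_succ_shift_of_mem {v : Fin G.n} (hv : v ∈ G.target) {i : ℕ} {B p : ℝ}
    (hB : B ∈ Set.Ioc (0 : ℝ) 1) :
    (B, p) ∈ G.toBiddingGame.sval (i + 1) (shift v) ↔ p = 1 := by
  constructor
  · intro h
    obtain ⟨-, b, b', ⟨w, hw, h1⟩, h2, rfl⟩ :=
      (BiddingGame.mem_bellman_control (toBiddingGame_node_shift_of_mem hv)).1 h
    obtain rfl : w = (0 : Fin (G.n + 2)) := Finset.mem_singleton.1 hw
    by_contra hp
    have h3 := (sval_toBiddingGame_zero h1).resolve_right hp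
    have h4 := (sval_toBiddingGame_zero (h2 _ hw)).resolve_right hp
    linarith [hB.1]
  · rintro rfl
    exact BiddingGame.mem_sval_one _ _ ⟨hB.1.le, hB.2⟩

/-- The target sink forces `Bplus = 0`, hence `Bminus = 2/3`, which is not safe at that sink: the
successor lies in the game. If `p = 1`, nothing is forced, but every successor will do. -/
theorem mem_sval_succ_shift_player1 {v : Fin G.n} (hv : v ∉ G.target) {S : Finset (Fin G.n)}
    (hS : G.node v = .player1 S) {i : ℕ} {p : ℝ} (hp : p ∈ Set.Icc (0 : ℝ) 1) :
    (1 / 3, p) ∈ G.toBiddingGame.sval (i + 1) (shift v) ↔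
      ∃ w ∈ S, (2 / 3, p) ∈ G.toBiddingGame.sval i (shift w) := by
  have hn : G.toBiddingGame.node (shift v) =
      .control (insert (0 : Fin (G.n + 2)) (S.map shift)) := by
    rw [toBiddingGame_node_shift hv, hS]; rfl
  have hS' : ∃ w, w ∈ S := by simpa [hS, SSGNode.succ] using G.exists_mem_succ v
  refine (BiddingGame.mem_bellman_control hn).trans ?_
  constructor
  · rintro ⟨-, b, b', ⟨w, hw, h1⟩, h2, h3⟩
    by_cases hp1 : p = 1
    · obtain ⟨w, hw⟩ := hS'
      subst hp1
      exact ⟨w, hw, BiddingGame.mem_sval_one _ _ (by constructor <;> norm_num)⟩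
    · have hb' := (sval_toBiddingGame_zero
        (h2 (0 : Fin (G.n + 2)) (Finset.mem_insert_self _ _))).resolve_right hp1
      have hb : b = 2 / 3 := by linarith
      subst hb
      rcases Finset.mem_insert.1 hw with rfl | hw
      · exact absurd (sval_toBiddingGame_zero h1) (by simp [hp1])
      · obtain ⟨w, hwS, rfl⟩ := Finset.mem_map.1 hw
        exact ⟨w, hwS, h1⟩
  · rintro ⟨w, hw, h1⟩
    exact ⟨hp, 2 / 3, 0, ⟨shift w, Finset.mem_insert_of_mem (Finset.mem_map_of_mem _ hw), h1⟩,
      fun w _ => BiddingGame.zero_mem_sval _ _ hp, by norm_num⟩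

/-- As `Bminus` is at most 1, `Bplus` is at least 1/3, and safety is inherited by smaller budgets.
Conversely the safe sink permits `Bminus = 1`. -/
theorem mem_sval_succ_shift_player0 {v : Fin G.n} (hv : v ∉ G.target) {S : Finset (Fin G.n)}
    (hS : G.node v = .player0 S) {i : ℕ} {p : ℝ} (hp : p ∈ Set.Icc (0 : ℝ) 1) :
    (2 / 3, p) ∈ G.toBiddingGame.sval (i + 1) (shift v) ↔
      ∀ w ∈ S, (1 / 3, p) ∈ G.toBiddingGame.sval i (shift w) := by
  have hn : G.toBiddingGame.node (shift v) =
      .control (insert (1 : Fin (G.n + 2)) (S.map shift)) := by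
    rw [toBiddingGame_node_shift hv, hS]; rfl
  refine (BiddingGame.mem_bellman_control hn).trans ?_
  constructor
  · rintro ⟨-, b, b', ⟨w', -, h1⟩, h2, h3⟩ w hw
    have hb := (BiddingGame.mem_Icc_of_mem_sval h1).1.2
    exact BiddingGame.mem_sval_of_le (by norm_num) (by linarith)
      (h2 (shift w) (Finset.mem_insert_of_mem (Finset.mem_map_of_mem _ hw)))
  · intro h
    refine ⟨hp, 1, 1 / 3, ⟨(1 : Fin (G.n + 2)), Finset.mem_insert_self _ _,
      sval_toBiddingGame_one _ (by simp) hp⟩, fun w hw => ?_, by norm_num⟩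
    rcases Finset.mem_insert.1 hw with rfl | hw
    · exact sval_toBiddingGame_one _ (by constructor <;> norm_num) hp
    · obtain ⟨w, hwS, rfl⟩ := Finset.mem_map.1 hw
      exact h w hwS

theorem mem_sval_succ_shift_random {v : Fin G.n} (hv : v ∉ G.target) {δ : Fin G.n → ℚ≥0}
    (hδ : G.node v = .random δ) {i : ℕ} {B p : ℝ} (hB : B ∈ Set.Icc (0 : ℝ) 1) :
    (B, p) ∈ G.toBiddingGame.sval (i + 1) (shift v) ↔ ∃ q : Fin G.n → ℝ,
      (∀ w, 0 < δ w → (B, q w) ∈ G.toBiddingGame.sval i (shift w)) ∧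
        p = ∑ w, (δ w : ℝ) * q w := by
  have hn : G.toBiddingGame.node (shift v) = .random (shiftDist δ) := by
    rw [toBiddingGame_node_shift hv, hδ]; rfl
  have hsum : ∀ q : Fin (G.n + 2) → ℝ,
      ∑ w, (shiftDist δ w : ℝ) * q w = ∑ w, (δ w : ℝ) * q (shift w) := by
    intro q
    rw [Fin.sum_univ_succ, Fin.sum_univ_succ]
    change ((0 : ℚ≥0) : ℝ) * _ + (((0 : ℚ≥0) : ℝ) * _ + ∑ w, (δ w : ℝ) * q (shift w)) = _
    simp
  refine (BiddingGame.mem_bellman_random hn).trans ?_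
  constructor
  · rintro ⟨-, q, h1, rfl⟩
    exact ⟨fun w => q (shift w), fun w hw => h1 (shift w) hw, hsum q⟩
  · rintro ⟨q, h1, rfl⟩
    -- The values at the sinks are arbitrary, since they have probability 0.
    let q' : Fin (G.n + 2) → ℝ := Fin.cons 0 (Fin.cons 0 q)
    refine ⟨hB, q', fun w => ?_, (hsum q').symm⟩
    refine Fin.cases (fun h => absurd h (lt_irrefl _)) (fun w => ?_) w
    refine Fin.cases (fun h => absurd h (lt_irrefl _)) (fun w => ?_) w
    exact h1 w

/-- With the budget of the phase, the safety values are given by value iteration. -/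
theorem mem_sval_shift_iff (i : ℕ) {j : ℕ} {v : Fin G.n} (h : G.Alternates j v) {p : ℝ} :
    (budget j, p) ∈ G.toBiddingGame.sval i (shift v) ↔ G.iterValue i v ≤ p ∧ p ≤ 1 := by
  induction i generalizing j v p with
  | zero =>
    -- No vertex of the game is itself a target of the reduction, so the full square matches
    -- `iterValue 0 = 0` even at the targets of the game.
    rw [BiddingGame.sval_zero_of_notMem (shift_notMem_target v)]
    exact ⟨fun h => h.2, fun h => ⟨budget_mem_Icc j, h⟩⟩
  | succ i ih =>
    by_cases hv : v ∈ G.target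
    · rw [mem_sval_succ_shift_of_mem hv ⟨budget_pos j, (budget_mem_Icc j).2⟩, iterValue, if_pos hv]
      exact ⟨fun h => ⟨h.ge, h.le⟩, fun h => h.2.antisymm h.1⟩
    · by_cases hp : p ∈ Set.Icc (0 : ℝ) 1
      swap
      · constructor
        · exact fun h1 => absurd (BiddingGame.mem_Icc_of_mem_sval h1).2 hp
        · exact fun h1 => absurd ⟨(iterValue_nonneg _ _).trans h1.1, h1.2⟩ hp
      rw [iterValue, if_neg hv]
      have hs : ∀ w ∈ (G.node v).succ, G.Alternates (j + 1) w := fun w hw => h.succ hw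
      cases hn : G.node v with
      | player1 S =>
        rw [hn] at hs
        obtain ⟨h1, h2⟩ := budget_of_player1 h hn
        rw [h1, mem_sval_succ_shift_player1 hv hn hp, ← h2]
        constructor
        · rintro ⟨w, hw, h3⟩
          exact ⟨(optimize_player1_le hn _ hw).trans ((ih (hs w hw)).1 h3).1, hp.2⟩
        · rintro ⟨h3, -⟩
          obtain ⟨w, hw, he⟩ := exists_eq_optimize_player1 hn (G.iterValue i)
          exact ⟨w, hw, (ih (hs w hw)).2 ⟨he.trans_le h3, hp.2⟩⟩
      | player0 S =>
        rw [hn] at hs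
        obtain ⟨h1, h2⟩ := budget_of_player0 h hn
        rw [h1, mem_sval_succ_shift_player0 hv hn hp, ← h2]
        constructor
        · intro h3
          obtain ⟨w, hw, he⟩ := exists_eq_optimize_player0 hn (G.iterValue i)
          exact ⟨he.symm.trans_le ((ih (hs w hw)).1 (h3 w hw)).1, hp.2⟩
        · rintro ⟨h3, -⟩ w hw
          exact (ih (hs w hw)).2 ⟨(le_optimize_player0 hn _ hw).trans h3, hp.2⟩
      | random δ =>
        have hs' : ∀ w, 0 < δ w → G.Alternates (j + 1) w := fun w hw =>
          hs w (by simpa [hn, SSGNode.succ] using hw)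
        rw [mem_sval_succ_shift_random hv hn (budget_mem_Icc j), ← budget_of_random h hn,
          optimize_random hn]
        constructor
        · rintro ⟨q, h1, rfl⟩
          refine ⟨Finset.sum_le_sum fun w _ => ?_, hp.2⟩
          rcases eq_or_ne (δ w) 0 with h0 | h0
          · simp [h0]
          · have hw := pos_iff_ne_zero.2 h0
            exact mul_le_mul_of_nonneg_left ((ih (hs' w hw)).1 (h1 w hw)).1 (by positivity)
        · rintro ⟨h1, -⟩
          -- A `p` above the average of the iterates must be written as an average of admissible
          -- values: move all iterates by the same fraction `c` of their distance towards 1.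
          obtain ⟨c, hc, rfl⟩ : ∃ c ∈ Set.Icc (0 : ℝ) 1,
              (∑ w, (δ w : ℝ) * G.iterValue i w) +
                c * (1 - ∑ w, (δ w : ℝ) * G.iterValue i w) = p := by
            set V := ∑ w, (δ w : ℝ) * G.iterValue i w
            rcases (h1.trans hp.2).eq_or_lt with h2 | h2
            · exact ⟨0, by simp, by linarith [hp.2]⟩
            · have h3 : 0 < 1 - V := by linarith
              refine ⟨(p - V) / (1 - V), ⟨div_nonneg (by linarith) h3.le,
                (div_le_one h3).2 (by linarith [hp.2])⟩, ?_⟩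
              rw [div_mul_cancel₀ _ h3.ne']
              ring
          refine ⟨fun w => G.iterValue i w + c * (1 - G.iterValue i w), fun w hw => ?_, ?_⟩
          · have h2 := iterValue_le_one i w
            exact (ih (hs' w hw)).2 ⟨by nlinarith [hc.1], by nlinarith [hc.2]⟩
          · simp only [mul_add, mul_sub, mul_one, Finset.sum_add_distrib, Finset.sum_sub_distrib,
              mul_left_comm _ c, ← Finset.mul_sum, ← Finset.sum_mul, sum_dist hn, one_mul]

theorem mem_svalStar_toBiddingGame_init (G : SSG) {p : ℝ} :
    (1 / 3, p) ∈ G.toBiddingGame.svalStar G.toBiddingGame.init ↔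
      G.value G.init ≤ p ∧ p ≤ 1 := by
  rw [value_eq_limValue, limValue_le_iff, BiddingGame.svalStar, Set.mem_iInter]
  have h : ∀ i, (1 / 3, p) ∈ G.toBiddingGame.sval i G.toBiddingGame.init ↔
      G.iterValue i G.init ≤ p ∧ p ≤ 1 := by
    intro i
    rw [← mem_sval_shift_iff i G.alternates_init]
    simp only [budget, Nat.zero_mod, true_or, if_true]
    rfl
  simp only [h]
  exact ⟨fun h => ⟨fun i => (h i).1, (h 0).2⟩, fun h i => ⟨h.1 i, h.2⟩⟩

theorem value_le_one (v : Fin G.n) : G.value v ≤ 1 := by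
  rw [value_eq_limValue]
  exact limValue_le_iff.2 fun k => iterValue_le_one k v

end SSG

end BiddingGames

/-! ### Assembly of the reduction -/

theorem mainTheorem7 :
    ∃ F : BiddingGames.SSG → BiddingGames.BiddingGame,
      (∃ P : Polynomial ℕ, ∀ G : BiddingGames.SSG, (F G).size ≤ P.eval G.size) ∧
      (∀ G : BiddingGames.SSG,
        IsGreatest (G.guaranteed G.init) (G.value G.init) ∧
        IsLeast {p : ℝ | ((1 / 3 : ℝ), p) ∈ (F G).svalStar (F G).init} (G.value G.init)) ∧
      ∃ R : BiddingGames.SSGInstance → BiddingGames.BiddingInstance,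
        (∀ x, (R x).game = F x.game ∧ (R x).B = 1 / 3 ∧ (R x).p = x.p) ∧
        Nonempty (Turing.TM2ComputableInPolyTime BiddingGames.SSGInstance.encode
          BiddingGames.BiddingInstance.encode R) ∧
        ∀ x, x.Holds ↔ (R x).Holds := by
  refine ⟨BiddingGames.SSG.toBiddingGame,
    ⟨Polynomial.C BiddingGames.reduction.maxOut * Polynomial.X + Polynomial.C 2, fun G => ?_⟩,
    fun G => ⟨?_, ?_, ?_⟩, BiddingGames.SSGInstance.toBiddingInstance, fun x => ⟨rfl, rfl, rfl⟩,
    BiddingGames.nonempty_computableInPolyTime_toBiddingInstance, fun x => ?_⟩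
  · rw [Polynomial.eval_add, Polynomial.eval_mul, Polynomial.eval_C, Polynomial.eval_X,
      Polynomial.eval_C]
    exact G.size_toBiddingGame_le
  · rw [BiddingGames.SSG.value_eq_limValue]
    exact BiddingGames.SSG.isGreatest_guaranteed G.init
  · exact G.mem_svalStar_toBiddingGame_init.2 ⟨le_rfl, BiddingGames.SSG.value_le_one G.init⟩
  · exact fun p hp => (G.mem_svalStar_toBiddingGame_init.1 hp).1
  · have hB : ((x.toBiddingInstance.B : ℚ≥0) : ℝ) = 1 / 3 := by
      change (((1 / 3 : ℚ≥0)) : ℝ) = 1 / 3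
      norm_num
    rw [BiddingGames.BiddingInstance.Holds, hB]
    refine Iff.trans ?_ x.game.mem_svalStar_toBiddingGame_init.symm
    exact ⟨fun h => ⟨h, by exact_mod_cast x.p_le⟩, fun h => h.1⟩
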